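/- Let $\mathcal{H}$ be a complex Hilbert space of dimension $d\ge 1$, let $n\ge 0$ be an integer, and let $\mathcal{H}'$ be a finite-dimensional complex Hilbert space. Put $$\tau_{\mathcal{H}^n}=\int \sigma^{\otimes n}\,d\mu(\sigma)\in\mathrm{End}(\mathcal{H}^{\otimes n}),$$ where $\mu$ is the probability measure on the set of density operators on $\mathcal{H}$ induced by the Hilbert–Schmidt metric, i.e. the normalized $(d^2-1)$-dimensional volume of this metric. For a permutation $\pi$ of $\{1,\dots,n\}$, let $\pi$ also denote the operator $\pi|i_1\cdots i_n\rangle=|i_{\pi^{-1}(1)}\cdots i_{\pi^{-1}(n)}\rangle$ on $\mathcal{H}^{\otimes n}$, for $\{|i\rangle\}$ an orthonormal basis of $\mathcal{H}$, and the map $\rho\mapsto\pi\rho\pi^{-1}$ on $\mathrm{End}(\mathcal{H}^{\otimes n})$. Let $\|\sigma\|_1=\mathrm{tr}\sqrt{\sigma^\dagger\sigma}$ be the trace norm, and for a linear map $\Delta$ let $$\|\Delta\|_\diamond=\sup_{k\in\mathbb{N}}\ \sup_{\|\sigma\|_1\le 1}\|(\Delta\otimes\mathsf{id}_k)(\sigma)\|_1,$$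 where $\mathsf{id}_k$ is the identity map on $\mathrm{End}(\mathbb{C}^k)$. Let $\Delta:\mathrm{End}(\mathcal{H}^{\otimes n})\to\mathrm{End}(\mathcal{H}')$ be a linear map such that for every permutation $\pi$ of $\{1,\dots,n\}$ there exists a completely positive trace-preserving map $\mathcal{K}_\pi:\mathrm{End}(\mathcal{H}')\to\mathrm{End}(\mathcal{H}')$ with $\Delta\circ\pi=\mathcal{K}_\pi\circ\Delta$. Let $\mathcal{R}$ be a finite-dimensional Hilbert space and let $\tau_{\mathcal{H}^n\mathcal{R}}$ be any purification of $\tau_{\mathcal{H}^n}$, that is, a pure state on $\mathcal{H}^{\otimes n}\otimes\mathcal{R}$ with $\mathrm{tr}_{\mathcal{R}}\,\tau_{\mathcal{H}^n\mathcal{R}}=\tau_{\mathcal{H}^n}$. Then $$\|\Delta\|_\diamond\le g_{n,d}\,\bigl\|(\Delta\otimes\mathsf{id})(\tau_{\mathcal{H}^n\mathcal{R}})\bigr\|_1,$$ where $\mathsf{id}$ is the identity map on $\mathrm{End}(\mathcal{R})$ and $$g_{n,d}=\binom{n+d^2-1}{n}\le (n+1)^{d^2-1}.$$ -/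

import Mathlib

namespace PostSelection

noncomputable section

open scoped ComplexOrder MeasureTheory ENNReal

/-! Finite-dimensional Hilbert spaces are given by finite index types of orthonormal bases, so that
`End` of the space is the algebra of square complex matrices.  The space `H` of dimension `d` has
the index type `Fin d`, its tensor power `H^{⊗ n}` has the index type `Fin n → Fin d`, and a tensor
product of two spaces has the product of the index types. -/

/-- The trace norm `‖σ‖₁ = tr √(σ† σ)`. -/
def traceNorm {m : Type*} [Fintype m] [DecidableEq m] (σ : Matrix m m ℂ) : ℝ :=
  (Matrix.trace (cfc Real.sqrt (σ.conjTranspose * σ))).re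

/-- The map `F ⊗ id` on `End (A ⊗ R)`: `F` is applied to each of the blocks
`ρ_{rs} ∈ End A` of `ρ = ∑ ρ_{rs} ⊗ |r⟩⟨s|`. -/
def tensorId {m m' : Type*} (F : Matrix m m ℂ →ₗ[ℂ] Matrix m' m' ℂ) (r : Type*) :
    Matrix (m × r) (m × r) ℂ →ₗ[ℂ] Matrix (m' × r) (m' × r) ℂ where
  toFun ρ := Matrix.of fun a b =>
    F (Matrix.of fun i j => ρ (i, a.2) (j, b.2)) a.1 b.1
  map_add' ρ ρ' := by
    ext a b
    have h : (Matrix.of fun i j => (ρ + ρ') (i, a.2) (j, b.2)) =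
        (Matrix.of fun i j => ρ (i, a.2) (j, b.2)) +
          Matrix.of fun i j => ρ' (i, a.2) (j, b.2) := rfl
    exact congrFun (congrFun ((congrArg F h).trans (map_add F _ _)) a.1) b.1
  map_smul' c ρ := by
    ext a b
    have h : (Matrix.of fun i j => (c • ρ) (i, a.2) (j, b.2)) =
        c • Matrix.of fun i j => ρ (i, a.2) (j, b.2) := rfl
    exact congrFun (congrFun ((congrArg F h).trans (map_smul F _ _)) a.1) b.1

/-- The norm `‖F‖₁ = sup {‖F σ‖₁ : ‖σ‖₁ ≤ 1}` of a linear map, as an extended nonnegative real. -/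
def inducedTraceNorm {m m' : Type*} [Fintype m] [DecidableEq m] [Fintype m'] [DecidableEq m']
    (F : Matrix m m ℂ →ₗ[ℂ] Matrix m' m' ℂ) : ℝ≥0∞ :=
  ⨆ (σ : Matrix m m ℂ) (_ : traceNorm σ ≤ 1), ENNReal.ofReal (traceNorm (F σ))

/-- The diamond norm `‖F‖_⋄ = sup_k ‖F ⊗ id_k‖₁`, as an extended nonnegative real. -/
def diamondNorm {m m' : Type*} [Fintype m] [DecidableEq m] [Fintype m'] [DecidableEq m']
    (F : Matrix m m ℂ →ₗ[ℂ] Matrix m' m' ℂ) : ℝ≥0∞ :=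
  ⨆ k : ℕ, inducedTraceNorm (tensorId F (Fin k))

/-- Completely positive trace-preserving maps: `F ⊗ id_k` preserves positivity for every `k`, and
`F` preserves the trace. -/
def IsCPTP {m m' : Type*} [Fintype m] [Fintype m']
    (F : Matrix m m ℂ →ₗ[ℂ] Matrix m' m' ℂ) : Prop :=
  (∀ (k : ℕ) (ρ : Matrix (m × Fin k) (m × Fin k) ℂ),
      ρ.PosSemidef → (tensorId F (Fin k) ρ).PosSemidef) ∧
    ∀ ρ : Matrix m m ℂ, (F ρ).trace = ρ.trace

/-- The operator `π |i₁ … iₙ⟩ = |i_{π⁻¹(1)} … i_{π⁻¹(n)}⟩` on `H^{⊗ n}`. -/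
def permOp {n : ℕ} (d : ℕ) (π : Equiv.Perm (Fin n)) :
    Matrix (Fin n → Fin d) (Fin n → Fin d) ℂ :=
  Matrix.of fun a i => if a = i ∘ ⇑π⁻¹ then 1 else 0

/-- The map `ρ ↦ π ρ π⁻¹` on `End (H^{⊗ n})`. -/
def permMap {n : ℕ} (d : ℕ) (π : Equiv.Perm (Fin n)) :
    Matrix (Fin n → Fin d) (Fin n → Fin d) ℂ →ₗ[ℂ]
      Matrix (Fin n → Fin d) (Fin n → Fin d) ℂ :=
  LinearMap.mulLeft ℂ (permOp d π) ∘ₗ LinearMap.mulRight ℂ (permOp d π⁻¹)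

/-- The metric space `End H` with the Hilbert–Schmidt metric: the squared norm of `x` is
`∑_{i,j} |x_{ij}|²`. -/
abbrev HSSpace (d : ℕ) : Type := EuclideanSpace ℂ (Fin d × Fin d)

/-- An element of the Hilbert–Schmidt space, as a matrix. -/
def HSSpace.toMatrix {d : ℕ} (x : HSSpace d) : Matrix (Fin d) (Fin d) ℂ :=
  Matrix.of fun i j => x (i, j)

/-- The set of density operators on `H`, in the Hilbert–Schmidt space. -/
def densityOperators (d : ℕ) : Set (HSSpace d) :=
  {x | x.toMatrix.PosSemidef ∧ x.toMatrix.trace = 1}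

/-- The probability measure on the set of density operators that is induced by the
Hilbert–Schmidt metric: the normalized volume of this metric in dimension `d² - 1`, which is the
dimension of the set of density operators. -/
def hsMeasure (d : ℕ) : MeasureTheory.Measure (HSSpace d) :=
  ProbabilityTheory.cond (μH[(d : ℝ) ^ 2 - 1]) (densityOperators d)

/-- The tensor power `σ^{⊗ n}`. -/
def tensorPower (n : ℕ) {d : ℕ} (σ : Matrix (Fin d) (Fin d) ℂ) :
    Matrix (Fin n → Fin d) (Fin n → Fin d) ℂ :=
  Matrix.of fun i j => ∏ k, σ (i k) (j k)

/-- The de Finetti state `τ = ∫ σ^{⊗ n} dμ(σ)`; the integral of a matrix is taken entrywise. -/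
def deFinettiState (n d : ℕ) : Matrix (Fin n → Fin d) (Fin n → Fin d) ℂ :=
  Matrix.of fun i j => ∫ x, tensorPower n x.toMatrix i j ∂(hsMeasure d)

/-- The partial trace over the second factor. -/
def partialTrace {m r : Type*} [Fintype r] (ω : Matrix (m × r) (m × r) ℂ) : Matrix m m ℂ :=
  Matrix.of fun i j => ∑ a, ω (i, a) (j, a)

/-- A pure state: `|ψ⟩⟨ψ|` for a unit vector `ψ`. -/
def IsPureState {m : Type*} [Fintype m] (ω : Matrix m m ℂ) : Prop :=
  ∃ ψ : m → ℂ, ∑ i, ‖ψ i‖ ^ 2 = 1 ∧ ω = Matrix.vecMulVec ψ (star ψ)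

/-- `ω` is a purification of `ρ`: a pure state on `A ⊗ R` whose partial trace over `R` is `ρ`. -/
def IsPurification {m r : Type*} [Fintype m] [Fintype r]
    (ω : Matrix (m × r) (m × r) ℂ) (ρ : Matrix m m ℂ) : Prop :=
  IsPureState ω ∧ partialTrace ω = ρ

/-- The constant `g_{n,d} = C(n + d² - 1, n)`, for `d ≥ 1`. -/
def postSelectionConst (n d : ℕ) : ℕ := (n + d ^ 2 - 1).choose n

end

end PostSelection

/-! The heart of the matter is that the de Finetti state dominates every permutation-invariant
state: `g τ - M` is positive for each invariant `M ≥ 0` of trace at most 1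
(`dominates_deFinettiState`). The square root of such an `M`, read as a vector of `(H ⊗ K)^{⊗ n}`
with `K` a copy of `H`, lies in the symmetric subspace. Its projector is therefore dominated by the
symmetric one, and tracing out `K^{⊗ n}` gives `n! M ≤ symmetricTrace n d`. It remains to see that
`symmetricTrace n d = g n! τ`.

That identity (`deFinettiState_eq_symmetricTrace`) is a moment computation. Writing a positive
matrix as `W = t σ` with `t = tr W` turns the moments of `σ` into those of the density `e^{-tr W}`
on the positive cone, up to the factor `(d² - 1 + n)!`. Volume on the Hermitian matrices is changed
by `W ↦ S W Sᴴ` only by the Jacobian `|det S|^{2d}`. Differentiating the resulting change of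
variables at `S = 1` gives a recursion in `n` (`coneMoment_cons`), and sorting permutations by the
image of the first point gives the same recursion for the partial trace (`symmetricTrace_cons`).

The norm bound (`traceNorm_tensorId_le_of_dominates`) follows from domination. Factor the input as
`σ = X Yᴴ` with `X`, `Y` of Hilbert–Schmidt norm at most 1. The permuted copies of `X`, each
labelled by an orthogonal flag, form a matrix whose square is invariant and hence below `g τ`. By
Douglas' lemma it is obtained from the purification by some `C` acting on `R` with `C Cᴴ ≤ g`;
likewise `Y` gives `D`. So every `(Δ ∘ π⁻¹ ⊗ id)(σ) / n!` comes from `(Δ ⊗ id)(τ)` through `C` and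
`D`, and `K_π` turns it into `(Δ ⊗ id)(σ) / n!`. Summed over `π`, complete positivity exhibits `(Δ ⊗
id)(σ)` as the off-diagonal block of a positive matrix whose diagonal blocks have trace at most `g
‖(Δ ⊗ id)(τ)‖₁`, which bounds its trace norm (`traceNorm_le_of_fromBlocks`). -/

namespace PostSelection

noncomputable section

open scoped ComplexOrder MeasureTheory ENNReal Matrix

/-! ### Functional calculus of matrices and the trace norm. -/

section TraceNorm

variable {m : Type*} [Fintype m] [DecidableEq m]

theorem matrix_cfc_mul (f g : ℝ → ℝ) (h : Matrix m m ℂ) :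
    cfc f h * cfc g h = cfc (fun x => f x * g x) h :=
  (cfc_mul f g h (Matrix.finite_real_spectrum.continuousOn _)
    (Matrix.finite_real_spectrum.continuousOn _)).symm

theorem matrix_cfc_conjTranspose (f : ℝ → ℝ) (h : Matrix m m ℂ) :
    (cfc f h)ᴴ = cfc f h :=
  cfc_predicate (R := ℝ) (p := IsSelfAdjoint) f h

theorem conjTranspose_mul_self_eq_cfc (σ : Matrix m m ℂ) :
    σᴴ * σ = cfc (fun x : ℝ => x) (σᴴ * σ) :=
  (cfc_id' ℝ (σᴴ * σ) (Matrix.isHermitian_conjTranspose_mul_self σ)).symm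

theorem mul_cfc_conjTranspose_mul_self (σ : Matrix m m ℂ) (f g : ℝ → ℝ) :
    (σ * cfc f (σᴴ * σ))ᴴ * (σ * cfc g (σᴴ * σ)) =
      cfc (fun x => f x * x * g x) (σᴴ * σ) := by
  rw [Matrix.conjTranspose_mul, matrix_cfc_conjTranspose, Matrix.mul_assoc,
    ← Matrix.mul_assoc σᴴ]
  nth_rw 2 [conjTranspose_mul_self_eq_cfc σ]
  rw [matrix_cfc_mul, matrix_cfc_mul]
  simp only [mul_assoc]

theorem cfc_congr_of_posSemidef {M : Matrix m m ℂ} (hM : M.PosSemidef) {f g : ℝ → ℝ}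
    (h : ∀ x, 0 ≤ x → f x = g x) : cfc f M = cfc g M :=
  cfc_congr fun x hx => h x <| by
    obtain ⟨i, rfl⟩ := hM.isHermitian.spectrum_real_eq_range_eigenvalues ▸ hx
    exact hM.eigenvalues_nonneg i

theorem cfc_congr_nonneg (σ : Matrix m m ℂ) {f g : ℝ → ℝ} (h : ∀ x, 0 ≤ x → f x = g x) :
    cfc f (σᴴ * σ) = cfc g (σᴴ * σ) :=
  cfc_congr_of_posSemidef (Matrix.posSemidef_conjTranspose_mul_self σ) h

theorem cfc_sqrt_mul_cfc_sqrt {M : Matrix m m ℂ} (hM : M.PosSemidef) :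
    cfc Real.sqrt M * cfc Real.sqrt M = M := by
  rw [matrix_cfc_mul, cfc_congr_of_posSemidef hM fun x hx => Real.mul_self_sqrt hx]
  exact cfc_id' ℝ M hM.isHermitian

/-- `σ` vanishes on the kernel of `σᴴ * σ`, so the value of `f` at 0 is irrelevant. This lets
inverse powers of `|σ|` be used with the convention `0⁻¹ = 0`. -/
theorem mul_cfc_eq_self (σ : Matrix m m ℂ) {f : ℝ → ℝ} (h : ∀ x, 0 < x → f x = 1) :
    σ * cfc f (σᴴ * σ) = σ := by
  have h1 : σ * cfc (fun _ => (1 : ℝ)) (σᴴ * σ) = σ := by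
    have h0 : cfc (fun _ => (1 : ℝ)) (σᴴ * σ) = 1 :=
      cfc_const_one ℝ (σᴴ * σ) (Matrix.isHermitian_conjTranspose_mul_self σ)
    rw [h0, mul_one]
  have h2 : σ * cfc (fun x => f x - 1) (σᴴ * σ) = 0 := by
    rw [← Matrix.conjTranspose_mul_self_eq_zero, mul_cfc_conjTranspose_mul_self,
      cfc_congr_nonneg σ (g := fun _ => 0), cfc_const_zero]
    intro x hx
    rcases hx.eq_or_lt with rfl | hx
    · simp
    · simp [h x hx]
  have h3 : cfc (fun x => f x - 1) (σᴴ * σ) = cfc f (σᴴ * σ) - cfc (fun _ => (1:ℝ)) (σᴴ * σ) :=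
    cfc_sub f _ _ (Matrix.finite_real_spectrum.continuousOn _)
      (Matrix.finite_real_spectrum.continuousOn _)
  rw [h3, mul_sub, h1, sub_eq_zero] at h2
  exact h2

/-- Every matrix factors as `X Yᴴ` with both squared Hilbert–Schmidt norms equal to `‖σ‖₁`. -/
theorem exists_factorization_traceNorm (σ : Matrix m m ℂ) :
    ∃ X Y : Matrix m m ℂ, σ = X * Yᴴ ∧ (X * Xᴴ).trace.re = traceNorm σ ∧
      (Y * Yᴴ).trace.re = traceNorm σ := by
  have key : ∀ x : ℝ, 0 < x → √(√x) ≠ 0 := fun x hx =>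
    (Real.sqrt_pos.2 (Real.sqrt_pos.2 hx)).ne'
  -- `X = σ |σ|^{-1/2}` and `Y = |σ|^{1/2}`; the argument `x` is an eigenvalue of `σᴴ * σ = |σ|²`,
  -- hence the double square roots.
  refine ⟨σ * cfc (fun x => (√(√x))⁻¹) (σᴴ * σ), cfc (fun x => √(√x)) (σᴴ * σ), ?_, ?_, ?_⟩
  · rw [matrix_cfc_conjTranspose, Matrix.mul_assoc, matrix_cfc_mul, mul_cfc_eq_self]
    intro x hx
    exact inv_mul_cancel₀ (key x hx)
  · rw [Matrix.trace_mul_comm, mul_cfc_conjTranspose_mul_self, traceNorm]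
    congr 2
    refine cfc_congr_nonneg σ fun x hx => ?_
    rcases hx.eq_or_lt with rfl | hx
    · simp
    · have h1 := Real.mul_self_sqrt (Real.sqrt_nonneg x)
      have h2 := Real.mul_self_sqrt hx.le
      have h3 := key x hx
      field_simp
      nlinarith
  · rw [matrix_cfc_conjTranspose, matrix_cfc_mul, traceNorm]
    congr 2
    exact cfc_congr_nonneg σ fun x hx => Real.mul_self_sqrt (Real.sqrt_nonneg x)

theorem posSemidef_one_sub_of_idempotent {E : Matrix m m ℂ} (h : Eᴴ = E) (h2 : E * E = E) :
    (1 - E).PosSemidef := by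
  have : 1 - E = (1 - E)ᴴ * (1 - E) := by
    rw [Matrix.conjTranspose_sub, h, Matrix.conjTranspose_one, mul_sub, sub_mul, sub_mul, h2]
    simp
  rw [this]
  exact Matrix.posSemidef_conjTranspose_mul_self _

theorem trace_mul_nonneg {A B : Matrix m m ℂ} (hA : A.PosSemidef) (hB : B.PosSemidef) :
    0 ≤ (A * B).trace.re := by
  obtain ⟨C, rfl⟩ : ∃ C, B = Cᴴ * C :=
    ⟨_, by rw [matrix_cfc_conjTranspose, cfc_sqrt_mul_cfc_sqrt hB]⟩
  rw [← Matrix.mul_assoc, Matrix.trace_mul_comm, ← Matrix.mul_assoc]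
  exact (Complex.le_def.1 (hA.mul_mul_conjTranspose_same C).trace_nonneg).1

/-- The trace norm is bounded by the diagonal blocks of a positive completion. -/
theorem traceNorm_le_of_fromBlocks {P Q σ : Matrix m m ℂ}
    (h : (Matrix.fromBlocks P σ σᴴ Q).PosSemidef) :
    2 * traceNorm σ ≤ P.trace.re + Q.trace.re := by
  -- The partial isometry of the polar decomposition `σ = U |σ|`.
  set U := σ * cfc (fun x => (√x)⁻¹) (σᴴ * σ) with hU
  have hP : P.PosSemidef := h.submatrix Sum.inl
  have hUσ : Uᴴ * σ = cfc Real.sqrt (σᴴ * σ) := by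
    have : σ * cfc (fun _ => (1:ℝ)) (σᴴ * σ) = σ := mul_cfc_eq_self σ fun _ _ => rfl
    rw [hU, ← this, this, ← congrArg (fun z => _ * z) this, mul_cfc_conjTranspose_mul_self]
    refine cfc_congr_nonneg σ fun x hx => ?_
    rcases hx.eq_or_lt with rfl | hx
    · simp
    · have h2 := Real.mul_self_sqrt hx.le
      have h3 := (Real.sqrt_pos.2 hx).ne'
      field_simp
      nlinarith
  have hσU : σᴴ * U = cfc Real.sqrt (σᴴ * σ) := by
    have := congrArg Matrix.conjTranspose hUσ
    rwa [Matrix.conjTranspose_mul, Matrix.conjTranspose_conjTranspose,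
      matrix_cfc_conjTranspose] at this
  have hUU : U * Uᴴ * U = U := by
    rw [Matrix.mul_assoc, hU, mul_cfc_conjTranspose_mul_self, Matrix.mul_assoc, matrix_cfc_mul]
    congr 1
    refine cfc_congr_nonneg σ fun x hx => ?_
    rcases hx.eq_or_lt with rfl | hx
    · simp
    · have h2 := Real.mul_self_sqrt hx.le
      have h3 := (Real.sqrt_pos.2 hx).ne'
      field_simp
      nlinarith
  have hE : (1 - U * Uᴴ).PosSemidef := by
    apply posSemidef_one_sub_of_idempotent
    · simp [Matrix.conjTranspose_mul]
    · rw [← Matrix.mul_assoc, hUU]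
  have h1 := trace_mul_nonneg hP hE
  -- Compression by the column `(-U, 1)` gives `Uᴴ P U - 2 |σ| + Q ≥ 0`, and `tr (Uᴴ P U) ≤ tr P`
  -- because `U Uᴴ` is a projector.
  have h2 := (h.conjTranspose_mul_mul_same (Matrix.fromRows (-U) (1 : Matrix m m ℂ))).trace_nonneg
  rw [Matrix.conjTranspose_fromRows_eq_fromCols_conjTranspose, Matrix.fromCols_mul_fromBlocks,
    Matrix.fromCols_mul_fromRows] at h2
  have h3 := (Complex.le_def.1 h2).1
  simp only [Matrix.conjTranspose_neg, Matrix.neg_mul, Matrix.mul_neg, Matrix.conjTranspose_one,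
    Matrix.one_mul, Matrix.mul_one, Matrix.add_mul, hσU, hUσ, Matrix.trace_add, Matrix.trace_neg,
    Complex.add_re, Complex.neg_re, neg_neg, neg_add] at h3
  rw [mul_sub, Matrix.trace_sub, Matrix.mul_one, Complex.sub_re, ← Matrix.mul_assoc,
    Matrix.trace_mul_comm, ← Matrix.mul_assoc] at h1
  unfold traceNorm
  simp only [Complex.zero_re] at h3
  linarith

end TraceNorm

/-! ### Domination of invariant states by the partial trace of the symmetrizer. -/

section Symmetric

variable {n d : ℕ}

/-- The partial trace over `K^{⊗ n}` of the sum of all permutation operators on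
`(H ⊗ K)^{⊗ n}`, where `K` is a copy of `H`. -/
def symmetricTrace (n d : ℕ) : Matrix (Fin n → Fin d) (Fin n → Fin d) ℂ :=
  Matrix.of fun i j => ∑ π : Equiv.Perm (Fin n), ∑ e : Fin n → Fin d,
    if i ∘ π = j ∧ e ∘ π = e then 1 else 0

theorem sum_comp_perm {α β : Type*} [Fintype α] [DecidableEq α] [Fintype β]
    {R : Type*} [AddCommMonoid R] (π : Equiv.Perm α) (F : (α → β) → R) :
    ∑ a, F (a ∘ π) = ∑ a, F a :=
  (Equiv.arrowCongr π.symm (Equiv.refl β)).sum_comp F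

theorem comp_perm_eq_iff {α β : Type*} (π : Equiv.Perm α) (a b : α → β) :
    a ∘ π = b ↔ a = b ∘ ⇑π⁻¹ := by
  constructor
  · rintro rfl; ext; simp
  · rintro rfl; ext; simp

theorem symmetricTrace_isHermitian : (symmetricTrace n d).IsHermitian := by
  ext i j
  simp only [symmetricTrace, Matrix.conjTranspose_apply, Matrix.of_apply, star_sum]
  rw [← Equiv.sum_comp (Equiv.inv (Equiv.Perm (Fin n)))]
  refine Finset.sum_congr rfl fun π _ => Finset.sum_congr rfl fun e _ => ?_
  have h1 : (j ∘ ⇑π⁻¹ = i) ↔ (i ∘ π = j) := by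
    rw [comp_perm_eq_iff π, eq_comm]
  have h2 : (e ∘ ⇑π⁻¹ = e) ↔ (e ∘ π = e) := by
    rw [comp_perm_eq_iff π, eq_comm]
  simp only [Equiv.inv_apply, h1, h2]
  split_ifs <;> simp

/-- The sum of all permutation operators squares to `n!` times itself: in the expanded square, the
contribution of a pair `(π, π')` depends only on `π⁻¹ π'`, so each relative permutation occurs `n!`
times. -/
theorem sum_symmetrized_sq (x : (Fin n → Fin d) → ℂ) :
    ∑ e : Fin n → Fin d, ∑ a : Fin n → Fin d, ∑ c : Fin n → Fin d,
      star (∑ π : Equiv.Perm (Fin n), if c ∘ π = e then x (a ∘ π) else 0) *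
        (∑ π : Equiv.Perm (Fin n), if c ∘ π = e then x (a ∘ π) else 0) =
      (n.factorial : ℂ) * (star x ⬝ᵥ symmetricTrace n d *ᵥ x) := by
  have h1 : ∀ a c : Fin n → Fin d, ∑ e : Fin n → Fin d,
      star (∑ π : Equiv.Perm (Fin n), if c ∘ π = e then x (a ∘ π) else 0) *
        (∑ π : Equiv.Perm (Fin n), if c ∘ π = e then x (a ∘ π) else 0) =
      ∑ π : Equiv.Perm (Fin n), ∑ π' : Equiv.Perm (Fin n),
        star (x (a ∘ π)) * if c ∘ π' = c ∘ π then x (a ∘ π') else 0 := by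
    intro a c
    simp only [star_sum, Finset.sum_mul]
    rw [Finset.sum_comm]
    refine Finset.sum_congr rfl fun π _ => ?_
    simp only [Finset.mul_sum]
    rw [Finset.sum_comm]
    refine Finset.sum_congr rfl fun π' _ => ?_
    rw [Finset.sum_eq_single (c ∘ π)]
    · simp
    · intro e _ he
      simp [he.symm]
    · simp
  have h2 : ∀ π : Equiv.Perm (Fin n), ∑ a : Fin n → Fin d, ∑ c : Fin n → Fin d,
      ∑ π' : Equiv.Perm (Fin n),
        (star (x (a ∘ π)) * if c ∘ π' = c ∘ π then x (a ∘ π') else 0) =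
      star x ⬝ᵥ symmetricTrace n d *ᵥ x := by
    intro π
    have h3 : ∀ a c : Fin n → Fin d, ∑ π' : Equiv.Perm (Fin n),
        (star (x (a ∘ π)) * if c ∘ π' = c ∘ π then x (a ∘ π') else 0) =
      ∑ π' : Equiv.Perm (Fin n),
        (star (x (a ∘ π)) * if (c ∘ π) ∘ π' = c ∘ π then x ((a ∘ π) ∘ π') else 0) := by
      intro a c
      rw [← Equiv.sum_comp (Equiv.mulLeft π)]
      rfl
    simp only [h3]
    rw [sum_comp_perm π (fun a => ∑ c : Fin n → Fin d, ∑ π' : Equiv.Perm (Fin n),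
        (star (x a) * if (c ∘ π) ∘ π' = c ∘ π then x (a ∘ π') else 0))]
    simp only [dotProduct, Matrix.mulVec, symmetricTrace, Matrix.of_apply, Pi.star_apply]
    refine Finset.sum_congr rfl fun a _ => ?_
    rw [sum_comp_perm π (fun c => ∑ π' : Equiv.Perm (Fin n),
        (star (x a) * if c ∘ π' = c then x (a ∘ π') else 0))]
    simp only [← Finset.mul_sum]
    congr 1
    simp only [Finset.sum_mul]
    rw [Finset.sum_comm, Finset.sum_comm (s := (Finset.univ : Finset (Fin n → Fin d)))]
    refine Finset.sum_congr rfl fun π' _ => ?_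
    rw [Finset.sum_comm]
    refine Finset.sum_congr rfl fun c _ => ?_
    rw [Finset.sum_eq_single (a ∘ π')]
    · simp
    · intro b _ hb
      simp [hb.symm]
    · simp
  rw [Finset.sum_comm]
  calc _ = ∑ a : Fin n → Fin d, ∑ c : Fin n → Fin d, ∑ π : Equiv.Perm (Fin n),
        ∑ π' : Equiv.Perm (Fin n),
        (star (x (a ∘ π)) * if c ∘ π' = c ∘ π then x (a ∘ π') else 0) := by
        refine Finset.sum_congr rfl fun a _ => ?_
        rw [Finset.sum_comm]
        exact Finset.sum_congr rfl fun c _ => h1 a c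
    _ = ∑ π : Equiv.Perm (Fin n), ∑ a : Fin n → Fin d, ∑ c : Fin n → Fin d,
        ∑ π' : Equiv.Perm (Fin n),
        (star (x (a ∘ π)) * if c ∘ π' = c ∘ π then x (a ∘ π') else 0) := by
        rw [Finset.sum_congr rfl fun a _ => Finset.sum_comm, Finset.sum_comm]
    _ = _ := by
        rw [Finset.sum_congr rfl fun π _ => h2 π]
        simp [Finset.card_univ, Fintype.card_perm]

/-- Invariance means commuting with the permutation operators, a property inherited by the
functional calculus; it is needed for the square root. -/
theorem cfc_comp_perm {M : Matrix (Fin n → Fin d) (Fin n → Fin d) ℂ} (hM : M.IsHermitian)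
    (hinv : ∀ (π : Equiv.Perm (Fin n)) i j, M (i ∘ π) (j ∘ π) = M i j) (f : ℝ → ℝ)
    (π : Equiv.Perm (Fin n)) (i j : Fin n → Fin d) :
    cfc f M (i ∘ π) (j ∘ π) = cfc f M i j := by
  have hc : ∀ N : Matrix (Fin n → Fin d) (Fin n → Fin d) ℂ,
      Commute N (permOp d π) ↔ ∀ i j, N (i ∘ π) (j ∘ π) = N i j := by
    intro N
    have hl : ∀ i j, (N * permOp d π) i j = N i (j ∘ ⇑π⁻¹) := by
      intro i j
      simp [Matrix.mul_apply, permOp]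
    have hr : ∀ i j, (permOp d π * N) i j = N (i ∘ π) j := by
      intro i j
      have : ∀ k : Fin n → Fin d, (i = k ∘ ⇑π⁻¹) ↔ (k = i ∘ π) := fun k => by
        rw [← comp_perm_eq_iff, eq_comm]
      simp only [Matrix.mul_apply, permOp, Matrix.of_apply, this, ite_mul, one_mul, zero_mul,
        Finset.sum_ite_eq', Finset.mem_univ, if_true]
    rw [commute_iff_eq, ← Matrix.ext_iff]
    simp only [hl, hr]
    constructor
    · intro h i j
      rw [← h]
      congr 1
      ext; simp
    · intro h i j
      rw [← h]
      congr 1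
      ext; simp
  refine (hc _).1 ?_ i j
  exact IsSelfAdjoint.commute_cfc hM ((hc M).2 (hinv π)) f

/-- Permutation-invariant states are dominated by the partial trace of the projector onto the
symmetric subspace of `(H ⊗ K)^{⊗ n}`. -/
theorem posSemidef_symmetricTrace_sub {M : Matrix (Fin n → Fin d) (Fin n → Fin d) ℂ}
    (hM : M.PosSemidef) (hinv : ∀ (π : Equiv.Perm (Fin n)) i j, M (i ∘ π) (j ∘ π) = M i j)
    (htr : M.trace.re ≤ 1) :
    (symmetricTrace n d - (n.factorial : ℂ) • M).PosSemidef := by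
  refine Matrix.PosSemidef.of_dotProduct_mulVec_nonneg ?_ ?_
  · refine symmetricTrace_isHermitian.sub ?_
    rw [Matrix.IsHermitian, Matrix.conjTranspose_smul, hM.isHermitian]
    simp
  intro x
  set w : (Fin n → Fin d) → (Fin n → Fin d) → (Fin n → Fin d) → ℂ := fun e a c =>
    ∑ π : Equiv.Perm (Fin n), if c ∘ π = e then x (a ∘ π) else 0 with hw
  set B := cfc Real.sqrt M with hB
  have hBh : Bᴴ = B := matrix_cfc_conjTranspose _ _
  have hBB : B * B = M := cfc_sqrt_mul_cfc_sqrt hM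
  have hBinv : ∀ (π : Equiv.Perm (Fin n)) i j, B (i ∘ π) (j ∘ π) = B i j :=
    cfc_comp_perm hM.isHermitian hinv _
  have hq : (n.factorial : ℂ) * (star x ⬝ᵥ symmetricTrace n d *ᵥ x) =
      ((∑ e, ∑ a, ∑ c, ‖w e a c‖ ^ 2 : ℝ) : ℂ) := by
    rw [← sum_symmetrized_sq]
    push_cast
    simp only [← Complex.conj_mul']
    rfl
  have hp : star x ⬝ᵥ M *ᵥ x = ((∑ e, ‖(B *ᵥ x) e‖ ^ 2 : ℝ) : ℂ) := by
    have : star x ⬝ᵥ M *ᵥ x = star (B *ᵥ x) ⬝ᵥ (B *ᵥ x) := by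
      rw [Matrix.star_mulVec, hBh, ← Matrix.dotProduct_mulVec, Matrix.mulVec_mulVec, hBB]
    rw [this, dotProduct]
    push_cast
    simp only [← Complex.conj_mul']
    rfl
  have hBtr : ∑ c, ∑ a, ‖B c a‖ ^ 2 = M.trace.re := by
    have : M.trace = ∑ c, ∑ a, B c a * star (B c a) := by
      rw [← hBB]
      nth_rw 2 [← hBh]
      simp [Matrix.trace, Matrix.mul_apply]
    rw [this]
    simp only [Complex.re_sum]
    refine Finset.sum_congr rfl fun c _ => Finset.sum_congr rfl fun a _ => ?_
    rw [Complex.star_def, Complex.mul_conj']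
    norm_cast
  -- Since `B` is invariant, each of the `n!` terms of `w` contributes the same value `(B x)_e`.
  have hBx : ∀ e, (n.factorial : ℂ) * (B *ᵥ x) e = ∑ c, ∑ a, B c a * w e a c := by
    intro e
    have h1 : ∀ π : Equiv.Perm (Fin n), (B *ᵥ x) e =
        ∑ c, ∑ a, B c a * if c ∘ π = e then x (a ∘ π) else 0 := by
      intro π
      simp only [comp_perm_eq_iff]
      rw [Finset.sum_eq_single (e ∘ ⇑π⁻¹)]
      · simp only [if_true, Matrix.mulVec, dotProduct]
        rw [← sum_comp_perm π]
        refine Finset.sum_congr rfl fun a _ => ?_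
        rw [← hBinv π (e ∘ ⇑π⁻¹) a]
        congr 2
        ext; simp
      · intro c _ hc
        simp only [hc, if_false, mul_zero, Finset.sum_const_zero]
      · simp
    have h2 : ∑ π : Equiv.Perm (Fin n), (B *ᵥ x) e = (n.factorial : ℂ) * (B *ᵥ x) e := by
      simp [Finset.card_univ, Fintype.card_perm]
    rw [← h2, Finset.sum_congr rfl fun π _ => h1 π, Finset.sum_comm]
    refine Finset.sum_congr rfl fun c _ => ?_
    rw [Finset.sum_comm]
    refine Finset.sum_congr rfl fun a _ => ?_
    rw [hw, Finset.mul_sum]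
  -- Cauchy–Schwarz, where the squared Hilbert–Schmidt norm of `B` is `tr M ≤ 1`.
  have hcs : ∀ e, ((n.factorial : ℝ) * ‖(B *ᵥ x) e‖) ^ 2 ≤ ∑ a, ∑ c, ‖w e a c‖ ^ 2 := by
    intro e
    have h1 : (n.factorial : ℝ) * ‖(B *ᵥ x) e‖ ≤
        ∑ p : (Fin n → Fin d) × (Fin n → Fin d), ‖B p.1 p.2‖ * ‖w e p.2 p.1‖ := by
      have := congrArg norm (hBx e)
      rw [norm_mul, Complex.norm_natCast] at this
      rw [this, ← Finset.univ_product_univ, Finset.sum_product]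
      refine (norm_sum_le _ _).trans (Finset.sum_le_sum fun c _ => ?_)
      refine (norm_sum_le _ _).trans (Finset.sum_le_sum fun a _ => ?_)
      rw [norm_mul]
    refine (pow_le_pow_left₀ (by positivity) h1 2).trans ?_
    refine (Finset.sum_mul_sq_le_sq_mul_sq _ _ _).trans ?_
    rw [← Finset.univ_product_univ, Finset.sum_product, Finset.sum_product, hBtr]
    refine (mul_le_of_le_one_left (by positivity) htr).trans ?_
    rw [Finset.sum_comm]
  have hsum : (n.factorial : ℝ) ^ 2 * ∑ e, ‖(B *ᵥ x) e‖ ^ 2 ≤ ∑ e, ∑ a, ∑ c, ‖w e a c‖ ^ 2 := by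
    rw [Finset.mul_sum]
    refine Finset.sum_le_sum fun e _ => ?_
    rw [← mul_pow]
    exact hcs e
  have hn : (0 : ℝ) < n.factorial := by exact_mod_cast n.factorial_pos
  have hq' : star x ⬝ᵥ symmetricTrace n d *ᵥ x =
      (((∑ e, ∑ a, ∑ c, ‖w e a c‖ ^ 2) / n.factorial : ℝ) : ℂ) := by
    rw [Complex.ofReal_div, ← hq, Complex.ofReal_natCast, mul_div_cancel_left₀]
    exact_mod_cast hn.ne'
  rw [Matrix.sub_mulVec, dotProduct_sub, Matrix.smul_mulVec, dotProduct_smul, hp, hq',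
    smul_eq_mul]
  have h0 : (0 : ℝ) ≤ (∑ e, ∑ a, ∑ c, ‖w e a c‖ ^ 2) / n.factorial -
      n.factorial * ∑ e, ‖(B *ᵥ x) e‖ ^ 2 := by
    rw [sub_nonneg, le_div_iff₀ hn]
    linarith
  exact_mod_cast h0

end Symmetric

/-! ### Recursion in `n` for the partial trace of the symmetrizer. -/

section Recursion

variable {n d : ℕ}

theorem symmetricTrace_zero (i j : Fin 0 → Fin d) : symmetricTrace 0 d i j = 1 := by
  simp [symmetricTrace, Subsingleton.elim _ j]

theorem cons_comp_decomposeFin_zero {α : Type*} (a b : α) (i j : Fin n → α)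
    (π : Equiv.Perm (Fin n)) :
    (Fin.cons a i : Fin (n + 1) → α) ∘ Equiv.Perm.decomposeFin.symm (0, π) = Fin.cons b j ↔
      a = b ∧ i ∘ π = j := by
  constructor
  · intro h
    refine ⟨by simpa using congrFun h 0, funext fun x => by simpa using congrFun h x.succ⟩
  · rintro ⟨rfl, rfl⟩
    refine funext fun x => ?_
    refine Fin.cases ?_ (fun x => ?_) x <;> simp

theorem cons_comp_decomposeFin_succ {α : Type*} (a b : α) (i j : Fin n → α) (k : Fin n)
    (π : Equiv.Perm (Fin n)) :
    (Fin.cons a i : Fin (n + 1) → α) ∘ Equiv.Perm.decomposeFin.symm (k.succ, π) = Fin.cons b j ↔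
      i k = b ∧ Function.update i k a ∘ π = j := by
  have key : ∀ x, (Fin.cons a i : Fin (n + 1) → α) (Equiv.Perm.decomposeFin.symm (k.succ, π) x.succ)
      = Function.update i k a (π x) := by
    intro x
    rw [Equiv.Perm.decomposeFin_symm_apply_succ]
    by_cases h : π x = k
    · simp [h]
    · rw [Equiv.swap_apply_of_ne_of_ne (Fin.succ_ne_zero _) (by simpa using h)]
      simp [h]
  constructor
  · intro h
    refine ⟨by simpa using congrFun h 0, funext fun x => ?_⟩
    have := congrFun h x.succ
    rw [Function.comp_apply, key] at this
    simpa using this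
  · rintro ⟨rfl, rfl⟩
    refine funext fun x => ?_
    refine Fin.cases ?_ (fun x => ?_) x
    · simp
    · rw [Function.comp_apply, key]; simp

/-- Permutations of `n + 1` points are sorted by the image of 0. If 0 is fixed, its label in `K` is
free, whence the factor `d`. Otherwise 0 is inserted into the cycle of some `k`, just before `k`,
and its label is forced. -/
theorem symmetricTrace_cons (a b : Fin d) (i j : Fin n → Fin d) :
    symmetricTrace (n + 1) d (Fin.cons a i) (Fin.cons b j) =
      (if a = b then (d : ℂ) else 0) * symmetricTrace n d i j +
        ∑ k, if i k = b then symmetricTrace n d (Function.update i k a) j else 0 := by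
  have hE : ∀ (π : Equiv.Perm (Fin (n + 1))) (P : Prop) [Decidable P],
      (∑ e : Fin (n + 1) → Fin d, if P ∧ e ∘ π = e then (1 : ℂ) else 0) =
        ∑ e : Fin n → Fin d, ∑ e0 : Fin d,
          if P ∧ (Fin.cons e0 e : Fin (n + 1) → Fin d) ∘ π = Fin.cons e0 e then (1 : ℂ) else 0 := by
    intro π P _
    rw [← Equiv.sum_comp (Fin.consEquiv fun _ => Fin d), Fintype.sum_prod_type, Finset.sum_comm]
    rfl
  simp only [symmetricTrace, Matrix.of_apply]
  rw [← Equiv.sum_comp Equiv.Perm.decomposeFin.symm, Fintype.sum_prod_type, Fin.sum_univ_succ]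
  congr 1
  · rw [Finset.mul_sum]
    refine Finset.sum_congr rfl fun π _ => ?_
    rw [hE, Finset.mul_sum]
    refine Finset.sum_congr rfl fun e _ => ?_
    simp only [cons_comp_decomposeFin_zero, true_and]
    rw [Finset.sum_const, Finset.card_univ, Fintype.card_fin, nsmul_eq_mul]
    split_ifs <;> simp_all
  · refine Finset.sum_congr rfl fun k _ => ?_
    simp only [hE, cons_comp_decomposeFin_succ]
    by_cases hk : i k = b
    swap
    · simp [hk]
    rw [if_pos hk]
    refine Finset.sum_congr rfl fun π _ => Finset.sum_congr rfl fun e _ => ?_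
    -- The label of the inserted point must agree with that of `k`.
    rw [Finset.sum_eq_single (e k)]
    · simp only [Function.update_eq_self, true_and, hk]
    · intro e0 _ h
      simp [h.symm]
    · simp

end Recursion

/-! ### Completely positive maps, block matrices and Douglas factorization. -/

section Channels

theorem tensorId_apply {m m' : Type*} (F : Matrix m m ℂ →ₗ[ℂ] Matrix m' m' ℂ) (r : Type*)
    (ρ : Matrix (m × r) (m × r) ℂ) (a b : m' × r) :
    tensorId F r ρ a b = F (Matrix.of fun i j => ρ (i, a.2) (j, b.2)) a.1 b.1 := rfl

theorem trace_tensorId {m m' r : Type*} [Fintype m] [Fintype m'] [Fintype r]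
    {F : Matrix m m ℂ →ₗ[ℂ] Matrix m' m' ℂ} (hF : ∀ ρ, (F ρ).trace = ρ.trace)
    (ρ : Matrix (m × r) (m × r) ℂ) : (tensorId F r ρ).trace = ρ.trace := by
  simp only [Matrix.trace, Matrix.diag_apply, tensorId_apply, Fintype.sum_prod_type]
  rw [Finset.sum_comm, Finset.sum_comm (s := (Finset.univ : Finset m))]
  exact Finset.sum_congr rfl fun c _ => hF (Matrix.of fun i j => ρ (i, c) (j, c))

/-- The rows of `A` and `B` are stacked over a doubled auxiliary space; complete positivity at level
`k + k` applied to the Gram matrix of the stack gives the four blocks at once. -/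
theorem IsCPTP.posSemidef_fromBlocks {m m' T : Type*} [Fintype m] [Fintype m'] [Fintype T]
    {F : Matrix m m ℂ →ₗ[ℂ] Matrix m' m' ℂ} (hF : IsCPTP F) {k : ℕ}
    (A B : Matrix (m × Fin k) T ℂ) :
    (Matrix.fromBlocks (tensorId F (Fin k) (A * Aᴴ)) (tensorId F (Fin k) (A * Bᴴ))
      (tensorId F (Fin k) (B * Aᴴ)) (tensorId F (Fin k) (B * Bᴴ))).PosSemidef := by
  let D : Matrix (m × Fin (k + k)) T ℂ := Matrix.of fun p t =>
    Sum.elim (fun c => A (p.1, c) t) (fun c => B (p.1, c) t) (finSumFinEquiv.symm p.2)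
  have h := (hF.1 (k + k) (D * Dᴴ) (Matrix.posSemidef_self_mul_conjTranspose D)).submatrix
    (Sum.elim (fun p : m' × Fin k => (p.1, finSumFinEquiv (Sum.inl p.2)))
      (fun p : m' × Fin k => (p.1, finSumFinEquiv (Sum.inr p.2))))
  convert h using 1
  ext (p | p) (q | q) <;>
  · simp only [Matrix.fromBlocks_apply₁₁, Matrix.fromBlocks_apply₁₂, Matrix.fromBlocks_apply₂₁,
      Matrix.fromBlocks_apply₂₂, Matrix.submatrix_apply, Sum.elim_inl, Sum.elim_inr,
      tensorId_apply, Matrix.mul_apply, Matrix.conjTranspose_apply, D, Matrix.of_apply,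
      Equiv.symm_apply_apply]

theorem posSemidef_sum_fromBlocks_traceNorm_le {m ι : Type*} [Fintype m] [DecidableEq m]
    (s : Finset ι) (P X Y Q : ι → Matrix m m ℂ)
    (h : ∀ i ∈ s, (Matrix.fromBlocks (P i) (X i) (Y i) (Q i)).PosSemidef) :
    2 * traceNorm (∑ i ∈ s, X i) ≤ (∑ i ∈ s, P i).trace.re + (∑ i ∈ s, Q i).trace.re := by
  have h1 : Matrix.fromBlocks (∑ i ∈ s, P i) (∑ i ∈ s, X i) (∑ i ∈ s, Y i) (∑ i ∈ s, Q i) =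
      ∑ i ∈ s, Matrix.fromBlocks (P i) (X i) (Y i) (Q i) := by
    ext (p | p) (q | q) <;> simp [Matrix.sum_apply]
  have h2 := Matrix.posSemidef_sum s h
  rw [← h1] at h2
  have h3 := (Matrix.isHermitian_fromBlocks_iff.1 h2.isHermitian).2.1
  rw [← h3] at h2
  exact traceNorm_le_of_fromBlocks h2

/-- Douglas' factorization lemma, for an invertible `Ψ Ψᴴ`. -/
theorem exists_eq_mul_of_le {ι r J : Type*} [Fintype ι] [DecidableEq ι] [Fintype r] [DecidableEq r]
    [Fintype J] (Ψ : Matrix ι r ℂ) (Z : Matrix ι J ℂ) {g : ℝ} (hg : 0 ≤ g)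
    (hG : ((g : ℂ) • (Ψ * Ψᴴ)).PosDef) (h : ((g : ℂ) • (Ψ * Ψᴴ) - Z * Zᴴ).PosSemidef) :
    ∃ C : Matrix r J ℂ, Ψ * C = Z ∧ ((g : ℂ) • (1 : Matrix r r ℂ) - C * Cᴴ).PosSemidef := by
  set G := (g : ℂ) • (Ψ * Ψᴴ) with hGdef
  have hu : IsUnit G.det := (Matrix.isUnit_iff_isUnit_det _).1 hG.isUnit
  have hGh : G⁻¹ᴴ = G⁻¹ := by rw [Matrix.conjTranspose_nonsing_inv, hG.isHermitian]
  set V : Matrix r ι ℂ := (g : ℂ) • (Ψᴴ * G⁻¹) with hV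
  have hVh : Vᴴ = (g : ℂ) • (G⁻¹ * Ψ) := by
    rw [hV, Matrix.conjTranspose_smul, Matrix.conjTranspose_mul, hGh]
    simp
  -- `V` is a right inverse of `Ψ` with `V Ψ` an orthogonal projector, so `C = V Z` satisfies `C Cᴴ
  -- ≤ V G Vᴴ = g V Ψ ≤ g`.
  have hΨV : Ψ * V = 1 := by
    rw [hV, Matrix.mul_smul, ← Matrix.mul_assoc, ← Matrix.smul_mul, ← hGdef,
      Matrix.mul_nonsing_inv _ hu]
  have hVΨ : Vᴴ * Ψᴴ = 1 := by
    rw [← Matrix.conjTranspose_mul, hΨV, Matrix.conjTranspose_one]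
  have hVG : (g : ℂ) • (V * Ψ) = V * G * Vᴴ := by
    rw [hVh, Matrix.mul_smul, ← Matrix.mul_assoc, Matrix.mul_nonsing_inv_cancel_right _ _ hu]
  have hE : (V * Ψ)ᴴ = V * Ψ := by
    rw [Matrix.conjTranspose_mul, hVh, hV, Matrix.mul_smul, Matrix.smul_mul, Matrix.mul_assoc]
  refine ⟨V * Z, by rw [← Matrix.mul_assoc, hΨV, Matrix.one_mul], ?_⟩
  have h1 : (1 - V * Ψ).PosSemidef := by
    refine posSemidef_one_sub_of_idempotent hE ?_
    rw [Matrix.mul_assoc, ← Matrix.mul_assoc Ψ, hΨV, Matrix.one_mul]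
  have h2 := h.mul_mul_conjTranspose_same V
  have h3 : (g : ℂ) • (1 : Matrix r r ℂ) - V * Z * (V * Z)ᴴ =
      (g : ℂ) • (1 - V * Ψ) + V * (G - Z * Zᴴ) * Vᴴ := by
    rw [Matrix.conjTranspose_mul, Matrix.mul_sub, Matrix.sub_mul, ← hVG, smul_sub]
    simp only [Matrix.mul_assoc]
    abel
  rw [h3]
  exact (h1.smul (by exact_mod_cast hg)).add h2

theorem sum_norm_sq_mul_le {r J : Type*} [Fintype r] [DecidableEq r] [Fintype J]
    {C : Matrix r J ℂ} {g : ℝ} (h : ((g : ℂ) • (1 : Matrix r r ℂ) - C * Cᴴ).PosSemidef)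
    (v : r → ℂ) : ∑ j, ‖∑ a, C a j * v a‖ ^ 2 ≤ g * ∑ a, ‖v a‖ ^ 2 := by
  have h0 := h.dotProduct_mulVec_nonneg (star v)
  have h1 : star (star v) ⬝ᵥ (C * Cᴴ) *ᵥ (star v) = ((∑ j, ‖∑ a, C a j * v a‖ ^ 2 : ℝ) : ℂ) := by
    have h2 : ∀ j, (Cᴴ *ᵥ star v) j = star (∑ a, C a j * v a) := by
      intro j
      simp [Matrix.mulVec, dotProduct]
    have h3 : star (star v) ⬝ᵥ (C * Cᴴ) *ᵥ (star v) = star (Cᴴ *ᵥ star v) ⬝ᵥ (Cᴴ *ᵥ star v) := by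
      rw [Matrix.star_mulVec, Matrix.conjTranspose_conjTranspose, ← Matrix.dotProduct_mulVec,
        Matrix.mulVec_mulVec]
    rw [h3, dotProduct]
    push_cast
    refine Finset.sum_congr rfl fun j _ => ?_
    rw [Pi.star_apply, h2, star_star, Complex.star_def, Complex.mul_conj']
  have h4 : star (star v) ⬝ᵥ (g : ℂ) • (star v) = ((g * ∑ a, ‖v a‖ ^ 2 : ℝ) : ℂ) := by
    rw [star_star, dotProduct_smul, dotProduct]
    push_cast
    simp only [← Complex.mul_conj']
    rfl
  rw [Matrix.sub_mulVec, dotProduct_sub, h1, Matrix.smul_mulVec, Matrix.one_mulVec, h4,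
    ← Complex.ofReal_sub] at h0
  have := Complex.zero_le_real.1 h0
  linarith

theorem trace_mul_conjTranspose_re {ι J : Type*} [Fintype ι] [Fintype J] (A : Matrix ι J ℂ) :
    (A * Aᴴ).trace.re = ∑ i, ∑ j, ‖A i j‖ ^ 2 := by
  simp only [Matrix.trace, Matrix.diag_apply, Matrix.mul_apply, Matrix.conjTranspose_apply,
    Complex.re_sum]
  refine Finset.sum_congr rfl fun c _ => Finset.sum_congr rfl fun a _ => ?_
  rw [Complex.star_def, Complex.mul_conj']
  norm_cast

end Channels

/-! ### From domination to the norm bound. -/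

section PostSelectionBound

variable {n d : ℕ}

theorem permMap_apply (π : Equiv.Perm (Fin n)) (ρ : Matrix (Fin n → Fin d) (Fin n → Fin d) ℂ)
    (i j : Fin n → Fin d) : permMap d π ρ i j = ρ (i ∘ π) (j ∘ π) := by
  have h : ∀ i k : Fin n → Fin d, (i = k ∘ ⇑π⁻¹) ↔ (k = i ∘ π) := fun i k => by
    rw [← comp_perm_eq_iff, eq_comm]
  simp only [permMap, LinearMap.comp_apply, LinearMap.mulLeft_apply, LinearMap.mulRight_apply,
    Matrix.mul_apply, permOp, Matrix.of_apply, h, ite_mul, one_mul, zero_mul, mul_ite, mul_one,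
    mul_zero, Finset.sum_ite_eq', Finset.mem_univ, if_true, inv_inv]

theorem permMap_mul_apply_inv (π : Equiv.Perm (Fin n))
    (ρ : Matrix (Fin n → Fin d) (Fin n → Fin d) ℂ) :
    permMap d π (permMap d π⁻¹ ρ) = ρ := by
  ext i j
  rw [permMap_apply, permMap_apply]
  congr 1 <;> · ext; simp

/-- The rows of all permuted copies of `X`, collected in one matrix on `H^{⊗ n}`. -/
def permStack {k : ℕ} {S : Type*} (X : Matrix ((Fin n → Fin d) × Fin k) S ℂ) :
    Matrix (Fin n → Fin d) (Fin k × Equiv.Perm (Fin n) × S) ℂ :=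
  Matrix.of fun i p => ((√(n.factorial : ℝ))⁻¹ : ℂ) * X (i ∘ ⇑p.2.1⁻¹, p.1) p.2.2

theorem sqrt_factorial_inv_mul_self (n : ℕ) :
    ((√(n.factorial : ℝ))⁻¹ : ℂ) * ((√(n.factorial : ℝ))⁻¹ : ℂ) = (n.factorial : ℂ)⁻¹ := by
  rw [← mul_inv, ← Complex.ofReal_mul, Real.mul_self_sqrt (Nat.cast_nonneg _),
    Complex.ofReal_natCast]

/-- Permuting the tensor factors only relabels the flag, over which the product sums. -/
theorem permStack_comp {k : ℕ} {S : Type*} [Fintype S]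
    (X : Matrix ((Fin n → Fin d) × Fin k) S ℂ) (π : Equiv.Perm (Fin n)) (i j : Fin n → Fin d) :
    (permStack X * (permStack X)ᴴ) (i ∘ π) (j ∘ π) = (permStack X * (permStack X)ᴴ) i j := by
  simp only [Matrix.mul_apply, Matrix.conjTranspose_apply, Fintype.sum_prod_type]
  refine Finset.sum_congr rfl fun c _ => ?_
  rw [← Equiv.sum_comp (Equiv.mulRight π)]
  refine Finset.sum_congr rfl fun π' _ => Finset.sum_congr rfl fun s _ => ?_
  have h : ∀ i : Fin n → Fin d, (i ∘ π) ∘ ⇑(π' * π)⁻¹ = i ∘ ⇑π'⁻¹ := by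
    intro i; ext; simp
  rw [Equiv.coe_mulRight]
  simp only [permStack, Matrix.of_apply, h]

theorem trace_permStack {k : ℕ} {S : Type*} [Fintype S]
    (X : Matrix ((Fin n → Fin d) × Fin k) S ℂ) :
    (permStack X * (permStack X)ᴴ).trace.re = (X * Xᴴ).trace.re := by
  rw [trace_mul_conjTranspose_re, trace_mul_conjTranspose_re]
  have hn : (0 : ℝ) < n.factorial := by exact_mod_cast n.factorial_pos
  have h1 : ∀ i : Fin n → Fin d, ∀ p : Fin k × Equiv.Perm (Fin n) × S, ‖permStack X i p‖ ^ 2 =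
      (n.factorial : ℝ)⁻¹ * ‖X (i ∘ ⇑p.2.1⁻¹, p.1) p.2.2‖ ^ 2 := by
    intro i p
    rw [permStack, Matrix.of_apply, norm_mul, mul_pow, norm_inv, Complex.norm_real,
      Real.norm_of_nonneg (Real.sqrt_nonneg _), inv_pow, Real.sq_sqrt hn.le]
  simp only [h1, Fintype.sum_prod_type, ← Finset.mul_sum]
  have h2 : ∑ i : Fin n → Fin d, ∑ c, ∑ π : Equiv.Perm (Fin n), ∑ s,
      ‖X (i ∘ ⇑π⁻¹, c) s‖ ^ 2 = ∑ π : Equiv.Perm (Fin n), ∑ i : Fin n → Fin d, ∑ c, ∑ s,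
      ‖X (i, c) s‖ ^ 2 := by
    rw [Finset.sum_congr rfl fun i _ => Finset.sum_comm, Finset.sum_comm]
    exact Finset.sum_congr rfl fun π _ =>
      sum_comp_perm π⁻¹ fun i => ∑ c, ∑ s, ‖X (i, c) s‖ ^ 2
  rw [h2, Finset.sum_const, Finset.card_univ, Fintype.card_perm, Fintype.card_fin, nsmul_eq_mul,
    inv_mul_cancel_left₀ hn.ne']

theorem sum_prod_reorder {P K G S T R : Type*} [Fintype P] [Fintype K] [Fintype G] [Fintype S]
    [Fintype T] [AddCommMonoid R] (f : P → T → K × G × S → R) :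
    ∑ π, ∑ p : P × K, ∑ q : S × T, f p.1 q.2 (p.2, π, q.1) = ∑ p, ∑ t, ∑ j, f p t j := by
  simp only [Fintype.sum_prod_type]
  rw [Finset.sum_comm]
  refine Finset.sum_congr rfl fun p _ => ?_
  rw [Finset.sum_comm, Finset.sum_comm (s := (Finset.univ : Finset T))]
  refine Finset.sum_congr rfl fun c _ => ?_
  rw [Finset.sum_comm (s := (Finset.univ : Finset T))]
  refine Finset.sum_congr rfl fun π _ => ?_
  rw [Finset.sum_comm]

/-- The post-selection bound for a state `ρ` that dominates all permutation-invariant states, up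
to the factor `g`. -/
theorem traceNorm_tensorId_le_of_dominates
    {m : Type*} [Fintype m] [DecidableEq m] {r : Type*} [Fintype r] [DecidableEq r]
    (Δ : Matrix (Fin n → Fin d) (Fin n → Fin d) ℂ →ₗ[ℂ] Matrix m m ℂ)
    (hΔ : ∀ π : Equiv.Perm (Fin n), ∃ K : Matrix m m ℂ →ₗ[ℂ] Matrix m m ℂ,
      IsCPTP K ∧ Δ ∘ₗ permMap d π = K ∘ₗ Δ)
    {ρ : Matrix (Fin n → Fin d) (Fin n → Fin d) ℂ} {g : ℝ} (hg : 0 ≤ g)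
    (hρ : ∀ M : Matrix (Fin n → Fin d) (Fin n → Fin d) ℂ, M.PosSemidef →
      (∀ (π : Equiv.Perm (Fin n)) i j, M (i ∘ π) (j ∘ π) = M i j) → M.trace.re ≤ 1 →
      ((g : ℂ) • ρ - M).PosSemidef)
    {τ : Matrix ((Fin n → Fin d) × r) ((Fin n → Fin d) × r) ℂ} (hτ : IsPurification τ ρ)
    {k : ℕ} {σ : Matrix ((Fin n → Fin d) × Fin k) ((Fin n → Fin d) × Fin k) ℂ}
    (hσ : traceNorm σ ≤ 1) :
    traceNorm (tensorId Δ (Fin k) σ) ≤ g * traceNorm (tensorId Δ r τ) := by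
  obtain ⟨⟨ψ, -, hψ⟩, hpt⟩ := hτ
  set Ψ : Matrix (Fin n → Fin d) r ℂ := Matrix.of fun i a => ψ (i, a) with hΨ
  have hρΨ : ρ = Ψ * Ψᴴ := by
    rw [← hpt, hψ]
    ext i j
    simp [partialTrace, Matrix.mul_apply, Ψ, Matrix.vecMulVec_apply]
  -- Domination applied to a small multiple of the identity gives the invertibility required by
  -- Douglas' lemma; the `+ 1` in `c` avoids any division by zero.
  have hG : ((g : ℂ) • (Ψ * Ψᴴ)).PosDef := by
    set c : ℝ := ((Fintype.card (Fin n → Fin d) : ℝ) + 1)⁻¹ with hc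
    have hc0 : 0 < c := by positivity
    have hp : ((c : ℂ) • (1 : Matrix (Fin n → Fin d) (Fin n → Fin d) ℂ)).PosDef :=
      Matrix.PosDef.one.smul (by exact_mod_cast hc0)
    have h1 := hρ _ hp.posSemidef (by
      intro π i j
      have : i ∘ π = j ∘ π ↔ i = j := by
        rw [comp_perm_eq_iff]
        have : (j ∘ ⇑π) ∘ ⇑π⁻¹ = j := by ext; simp
        rw [this]
      simp only [Matrix.smul_apply, Matrix.one_apply, this]) (by
      rw [Matrix.trace_smul, Matrix.trace_one, smul_eq_mul, Complex.re_ofReal_mul,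
        Complex.natCast_re, hc, inv_mul_le_iff₀ (by positivity)]
      linarith)
    rw [← hρΨ]
    have h2 := hp.posSemidef_add h1
    simpa using h2
  obtain ⟨X, Y, hXY, hX, hY⟩ := exists_factorization_traceNorm σ
  have hC : ∀ W : Matrix ((Fin n → Fin d) × Fin k) ((Fin n → Fin d) × Fin k) ℂ,
      (W * Wᴴ).trace.re ≤ 1 →
      ∃ C : Matrix r (Fin k × Equiv.Perm (Fin n) × (Fin n → Fin d) × Fin k) ℂ,
        Ψ * C = permStack W ∧
        ((g : ℂ) • (1 : Matrix r r ℂ) - C * Cᴴ).PosSemidef := by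
    intro W hW
    refine exists_eq_mul_of_le Ψ (permStack W) hg hG ?_
    rw [← hρΨ]
    exact hρ _ (Matrix.posSemidef_self_mul_conjTranspose _) (permStack_comp W)
      ((trace_permStack W).trans_le hW)
  obtain ⟨C, hCX, hCg⟩ := hC X (hX.trans_le hσ)
  obtain ⟨D, hDY, hDg⟩ := hC Y (hY.trans_le hσ)
  obtain ⟨X', Y', hω, hX', hY'⟩ := exists_factorization_traceNorm (tensorId Δ r τ)
  choose K hK hKΔ using hΔ
  -- `U C X' π` contracts the index in `R` of `X'` with `C`, at flag value `π`; the `Fin k` index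
  -- joins the rows and the inner index of the factorization of `σ` joins the columns.
  let U : Matrix r (Fin k × Equiv.Perm (Fin n) × ((Fin n → Fin d) × Fin k)) ℂ →
      Matrix (m × r) (m × r) ℂ → Equiv.Perm (Fin n) →
      Matrix (m × Fin k) (((Fin n → Fin d) × Fin k) × (m × r)) ℂ :=
    fun C X' π => Matrix.of fun p q => ∑ a, C a (p.2, π, q.1) * X' (p.1, a) q.2
  -- The maps `K π` preserve the trace, and the sum over the flag completes the columns of `C`, so
  -- that `C Cᴴ ≤ g` applies.
  have htr : ∀ C X', ((g : ℂ) • (1 : Matrix r r ℂ) - C * Cᴴ).PosSemidef →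
      (∑ π, tensorId (K π) (Fin k) (U C X' π * (U C X' π)ᴴ)).trace.re ≤
        g * (X' * X'ᴴ).trace.re := by
    intro C X' hC
    simp only [Matrix.trace_sum, trace_tensorId (hK _).2, Complex.re_sum,
      trace_mul_conjTranspose_re]
    calc _ = ∑ p, ∑ t, ∑ j, ‖∑ a, C a j * X' (p, a) t‖ ^ 2 := by
          exact sum_prod_reorder fun p t j => ‖∑ a, C a j * X' (p, a) t‖ ^ 2
      _ ≤ ∑ p, ∑ t, g * ∑ a, ‖X' (p, a) t‖ ^ 2 :=
          Finset.sum_le_sum fun p _ => Finset.sum_le_sum fun t _ =>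
            sum_norm_sq_mul_le hC fun a => X' (p, a) t
      _ = _ := by
          simp only [← Finset.mul_sum]
          rw [Fintype.sum_prod_type]
          congr 1
          exact Finset.sum_congr rfl fun p _ => Finset.sum_comm
  have hF : ∀ π, (n.factorial : ℂ)⁻¹ •
      tensorId (Δ ∘ₗ permMap d π⁻¹) (Fin k) σ = U C X' π * (U D Y' π)ᴴ := by
    intro π
    ext p q
    have h1 : (n.factorial : ℂ)⁻¹ • permMap d π⁻¹ (Matrix.of fun i j => σ (i, p.2) (j, q.2)) =
        ∑ s, ∑ a, ∑ b, (C a (p.2, π, s) * star (D b (q.2, π, s))) •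
          Matrix.of fun i j => τ (i, a) (j, b) := by
      have hX1 : ∀ i j, ∑ a, ψ (i, a) * C a j = permStack X i j := fun i j => by
        rw [← hCX]; rfl
      have hY1 : ∀ i j, ∑ a, ψ (i, a) * D a j = permStack Y i j := fun i j => by
        rw [← hDY]; rfl
      ext i j
      rw [Matrix.smul_apply, permMap_apply, Matrix.of_apply, hXY, Matrix.mul_apply, Finset.smul_sum]
      simp only [Matrix.sum_apply]
      refine Finset.sum_congr rfl fun s _ => ?_
      calc _ = permStack X i (p.2, π, s) * star (permStack Y j (q.2, π, s)) := by
            simp only [permStack, Matrix.of_apply, Matrix.conjTranspose_apply,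
              ← sqrt_factorial_inv_mul_self, smul_eq_mul, star_mul', star_inv₀, Complex.star_def,
              Complex.conj_ofReal]
            ring
        _ = _ := by
            rw [← hX1, ← hY1, star_sum, Finset.sum_mul_sum]
            refine Finset.sum_congr rfl fun a _ => Finset.sum_congr rfl fun b _ => ?_
            rw [Matrix.smul_apply, Matrix.of_apply, hψ, Matrix.vecMulVec_apply, star_mul',
              Pi.star_apply, smul_eq_mul]
            ring
    have h2 := congrArg (fun M => Δ M p.1 q.1) h1
    simp only [map_smul, map_sum, Matrix.sum_apply, Matrix.smul_apply] at h2
    rw [Matrix.smul_apply, tensorId_apply, LinearMap.comp_apply, h2, Matrix.mul_apply]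
    refine Eq.trans ?_ (Fintype.sum_prod_type _).symm
    refine Finset.sum_congr rfl fun s _ => ?_
    have h3 : ∀ a b, Δ (Matrix.of fun i j => τ (i, a) (j, b)) p.1 q.1 =
        ∑ t, X' (p.1, a) t * star (Y' (q.1, b) t) := by
      intro a b
      rw [← tensorId_apply Δ r τ (p.1, a) (q.1, b), hω]
      rfl
    simp only [h3, smul_eq_mul, Finset.mul_sum]
    simp only [U, Matrix.of_apply, Matrix.conjTranspose_apply, star_sum, Finset.sum_mul_sum]
    symm
    rw [Finset.sum_comm]
    refine Finset.sum_congr rfl fun a _ => ?_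
    rw [Finset.sum_comm]
    refine Finset.sum_congr rfl fun b _ => Finset.sum_congr rfl fun t _ => ?_
    rw [star_mul']
    ring
  -- `K π ∘ Δ ∘ π⁻¹ = Δ ∘ π ∘ π⁻¹ = Δ`, so all `n!` summands are equal.
  have hχ : tensorId Δ (Fin k) σ = ∑ π, tensorId (K π) (Fin k) (U C X' π * (U D Y' π)ᴴ) := by
    have h1 : ∀ π, tensorId (K π) (Fin k) (U C X' π * (U D Y' π)ᴴ) =
        (n.factorial : ℂ)⁻¹ • tensorId Δ (Fin k) σ := by
      intro π
      rw [← hF, map_smul]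
      congr 1
      ext p q
      have h2 := LinearMap.congr_fun (hKΔ π)
        (permMap d π⁻¹ (Matrix.of fun i j => σ (i, p.2) (j, q.2)))
      rw [LinearMap.comp_apply, LinearMap.comp_apply, permMap_mul_apply_inv] at h2
      rw [tensorId_apply Δ, h2]
      rfl
    rw [Finset.sum_congr rfl fun π _ => h1 π, Finset.sum_const, Finset.card_univ,
      Fintype.card_perm, Fintype.card_fin, ← Nat.cast_smul_eq_nsmul ℂ, smul_smul,
      mul_inv_cancel₀ (by exact_mod_cast n.factorial_ne_zero), one_smul]
  have h := posSemidef_sum_fromBlocks_traceNorm_le Finset.univ _ _ _ _ fun π _ =>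
    (hK π).posSemidef_fromBlocks (U C X' π) (U D Y' π)
  rw [← hχ] at h
  have h1 := htr C X' hCg
  have h2 := htr D Y' hDg
  rw [hX'] at h1
  rw [hY'] at h2
  linarith

end PostSelectionBound

/-! ### Hermitian matrices and the Jacobian of congruences. -/

section HermitianSpace

variable {d : ℕ}

theorem HSSpace.toMatrix_add (x y : HSSpace d) : (x + y).toMatrix = x.toMatrix + y.toMatrix := rfl

theorem HSSpace.toMatrix_smul (c : ℝ) (x : HSSpace d) : (c • x).toMatrix = c • x.toMatrix := rfl

theorem HSSpace.toMatrix_injective : Function.Injective (HSSpace.toMatrix (d := d)) := by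
  intro x y h
  ext p
  exact congrFun (congrFun h p.1) p.2

/-- The element of the Hilbert–Schmidt space given by a matrix. -/
def HSSpace.ofMatrix (A : Matrix (Fin d) (Fin d) ℂ) : HSSpace d :=
  WithLp.toLp 2 fun p => A p.1 p.2

/-- The real vector space of Hermitian matrices. -/
def hermSpace (d : ℕ) : Submodule ℝ (HSSpace d) where
  carrier := {x | x.toMatrix.IsHermitian}
  add_mem' {x y} hx hy := by
    rw [Set.mem_ofPred_eq, HSSpace.toMatrix_add]
    exact Matrix.IsHermitian.add hx hy
  zero_mem' := Matrix.isHermitian_zero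
  smul_mem' c x hx := by
    rw [Set.mem_ofPred_eq] at *
    rw [HSSpace.toMatrix_smul, Matrix.IsHermitian, Matrix.conjTranspose_smul, hx]
    simp

/-- The matrix of an element of `hermSpace d`. -/
def hermSpace.mat (x : hermSpace d) : Matrix (Fin d) (Fin d) ℂ := (x : HSSpace d).toMatrix

open hermSpace

theorem hermSpace.isHermitian_mat (x : hermSpace d) : (mat x).IsHermitian := x.2

theorem hermSpace.mat_injective : Function.Injective (mat (d := d)) :=
  HSSpace.toMatrix_injective.comp Subtype.val_injective

theorem hermSpace.mat_add (x y : hermSpace d) : mat (x + y) = mat x + mat y := rfl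

theorem hermSpace.mat_smul (c : ℝ) (x : hermSpace d) : mat (c • x) = c • mat x := rfl

/-- A Hermitian matrix, as an element of `hermSpace d`. -/
def hermSpace.mk (A : Matrix (Fin d) (Fin d) ℂ) (hA : A.IsHermitian) : hermSpace d :=
  ⟨HSSpace.ofMatrix A, hA⟩

theorem hermSpace.mat_mk (A : Matrix (Fin d) (Fin d) ℂ) (hA : A.IsHermitian) :
    mat (mk A hA) = A := rfl

theorem hermSpace.re_trace (x : hermSpace d) : (((mat x).trace.re : ℝ) : ℂ) = (mat x).trace := by
  have h : star (mat x).trace = (mat x).trace := by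
    rw [← Matrix.trace_conjTranspose, (isHermitian_mat x).eq]
  exact Complex.conj_eq_iff_re.1 h

/-- Every matrix is uniquely `P + i Q` with `P`, `Q` Hermitian, so the dimension is half of `2 d²`.
-/
theorem finrank_hermSpace : Module.finrank ℝ (hermSpace d) = d ^ 2 := by
  let f : (hermSpace d × hermSpace d) →ₗ[ℝ] HSSpace d :=
    { toFun p := (p.1 : HSSpace d) + Complex.I • (p.2 : HSSpace d)
      map_add' p q := by simp only [Prod.fst_add, Prod.snd_add, Submodule.coe_add, smul_add]; abel
      map_smul' c p := by
        simp only [Prod.smul_fst, Prod.smul_snd, Submodule.coe_smul, smul_add, RingHom.id_apply]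
        rw [smul_comm] }
  have hf : Function.Bijective f := by
    constructor
    · rw [← LinearMap.ker_eq_bot, LinearMap.ker_eq_bot']
      rintro ⟨p, q⟩ h
      have h1 : mat p + Complex.I • mat q = 0 := congrArg HSSpace.toMatrix h
      have h2 := congrArg Matrix.conjTranspose h1
      rw [Matrix.conjTranspose_add, Matrix.conjTranspose_smul, (isHermitian_mat p).eq,
        (isHermitian_mat q).eq, Matrix.conjTranspose_zero, Complex.star_def, Complex.conj_I,
        neg_smul] at h2
      have hp : (2 : ℂ) • mat p = 0 := by
        rw [two_smul]
        calc mat p + mat p = (mat p + Complex.I • mat q) + (mat p + -(Complex.I • mat q)) := by abel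
          _ = 0 := by rw [h1, h2, add_zero]
      have hp' : mat p = 0 := by simpa using hp
      rw [hp', zero_add] at h1
      have hq' : mat q = 0 := by simpa using h1
      exact Prod.ext (mat_injective hp') (mat_injective hq')
    · intro x
      set A := x.toMatrix with hA
      have h1 : ((2 : ℂ)⁻¹ • (A + Aᴴ)).IsHermitian := by
        rw [Matrix.IsHermitian, Matrix.conjTranspose_smul, Matrix.conjTranspose_add,
          Matrix.conjTranspose_conjTranspose, add_comm Aᴴ]
        simp
      have h2 : (-(2 : ℂ)⁻¹ • Complex.I • (A - Aᴴ)).IsHermitian := by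
        rw [Matrix.IsHermitian, Matrix.conjTranspose_smul, Matrix.conjTranspose_smul,
          Matrix.conjTranspose_sub, Matrix.conjTranspose_conjTranspose, ← neg_sub A]
        simp [-neg_sub]
      refine ⟨(mk _ h1, mk _ h2), HSSpace.toMatrix_injective ?_⟩
      change (2 : ℂ)⁻¹ • (A + Aᴴ) + Complex.I • (-(2 : ℂ)⁻¹ • Complex.I • (A - Aᴴ)) = A
      ext i j
      simp only [Matrix.add_apply, Matrix.smul_apply, Matrix.sub_apply, smul_eq_mul]
      linear_combination (-(2 : ℂ)⁻¹ * (A i j - Aᴴ i j)) * Complex.I_mul_I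
  have h := (LinearEquiv.ofBijective f hf).finrank_eq
  rw [Module.finrank_prod] at h
  have h2 : Module.finrank ℝ (HSSpace d) = 2 * d ^ 2 := by
    rw [finrank_real_of_complex, finrank_euclideanSpace]
    simp [sq]
  omega

/-- The congruence `W ↦ S W Sᴴ` on Hermitian matrices. -/
def congruence (S : Matrix (Fin d) (Fin d) ℂ) : hermSpace d →ₗ[ℝ] hermSpace d where
  toFun x := mk (S * mat x * Sᴴ) (Matrix.isHermitian_mul_mul_conjTranspose S (isHermitian_mat x))
  map_add' x y := mat_injective <| by
    simp only [mat_add, mat_mk, Matrix.mul_add, Matrix.add_mul]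
  map_smul' c x := mat_injective <| by
    simp only [mat_smul, mat_mk, Matrix.mul_smul, Matrix.smul_mul, RingHom.id_apply]

theorem mat_congruence (S : Matrix (Fin d) (Fin d) ℂ) (x : hermSpace d) :
    mat (congruence S x) = S * mat x * Sᴴ := rfl

theorem congruence_mul (S T : Matrix (Fin d) (Fin d) ℂ) :
    congruence (S * T) = congruence S ∘ₗ congruence T := by
  ext1 x
  apply mat_injective
  simp only [LinearMap.comp_apply, mat_congruence, Matrix.conjTranspose_mul, Matrix.mul_assoc]

/-- The Jacobian of the congruence by `S`. -/
def congruenceJac (S : Matrix (Fin d) (Fin d) ℂ) : ℝ := |LinearMap.det (congruence S)|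

theorem congruenceJac_mul (S T : Matrix (Fin d) (Fin d) ℂ) :
    congruenceJac (S * T) = congruenceJac S * congruenceJac T := by
  rw [congruenceJac, congruence_mul, LinearMap.det_comp, abs_mul]
  rfl

theorem congruenceJac_smul_one (s : ℂ) :
    congruenceJac (s • (1 : Matrix (Fin d) (Fin d) ℂ)) = (‖s‖ ^ 2) ^ d ^ 2 := by
  have : congruence (s • (1 : Matrix (Fin d) (Fin d) ℂ)) = (‖s‖ ^ 2) • LinearMap.id := by
    ext1 x
    apply mat_injective
    rw [mat_congruence, LinearMap.smul_apply, mat_smul, LinearMap.id_apply,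
      Matrix.conjTranspose_smul, Matrix.conjTranspose_one, Matrix.smul_mul, Matrix.mul_smul,
      Matrix.smul_mul, Matrix.one_mul, Matrix.mul_one, smul_smul]
    ext i j
    rw [Matrix.smul_apply, Matrix.smul_apply, smul_eq_mul, Complex.real_smul, Complex.star_def,
      Complex.conj_mul']
    norm_cast
  rw [congruenceJac, this, LinearMap.det_smul, LinearMap.det_id, finrank_hermSpace, mul_one,
    abs_of_nonneg (by positivity)]

theorem congruenceJac_one : congruenceJac (1 : Matrix (Fin d) (Fin d) ℂ) = 1 := by
  simpa using congruenceJac_smul_one (d := d) 1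

theorem congruenceJac_mul_inv {S T : Matrix (Fin d) (Fin d) ℂ} (h : S * T = 1) :
    congruenceJac S * congruenceJac T = 1 := by
  rw [← congruenceJac_mul, h, congruenceJac_one]

theorem congruenceJac_conj {S T : Matrix (Fin d) (Fin d) ℂ} (h : S * T = 1)
    (A : Matrix (Fin d) (Fin d) ℂ) : congruenceJac (S * A * T) = congruenceJac A := by
  rw [congruenceJac_mul, congruenceJac_mul, mul_right_comm, congruenceJac_mul_inv h, one_mul]

/-- A diagonal conjugation doubles `c`, which squares the transvection. The Jacobian is invariant
under conjugation, so it equals its own square, and it is nonzero. -/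
theorem congruenceJac_transvection {a b : Fin d} (hab : a ≠ b) (c : ℂ) :
    congruenceJac (Matrix.transvection a b c) = 1 := by
  have h2 : ∀ s : Fin d → ℂ, ∀ s' : Fin d → ℂ, (∀ i, s i * s' i = 1) →
      Matrix.diagonal s * Matrix.diagonal s' = 1 := by
    intro s s' h
    rw [Matrix.diagonal_mul_diagonal, ← Matrix.diagonal_one]
    exact congrArg _ (funext h)
  have h3 := congruenceJac_conj (h2 (fun i => if i = a then 2 else 1)
    (fun i => if i = a then 2⁻¹ else 1) (fun i => by split_ifs <;> simp))
    (Matrix.transvection a b c)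
  have h4 : Matrix.diagonal (fun i => if i = a then (2 : ℂ) else 1) * Matrix.transvection a b c *
      Matrix.diagonal (fun i => if i = a then (2 : ℂ)⁻¹ else 1) =
      Matrix.transvection a b c * Matrix.transvection a b c := by
    rw [Matrix.transvection_mul_transvection_same _ _ hab]
    ext i j
    rw [Matrix.mul_diagonal, Matrix.diagonal_mul]
    simp only [Matrix.transvection, Matrix.add_apply, Matrix.one_apply, Matrix.single_apply]
    by_cases hi : i = a <;> by_cases hj : j = b <;> subst_vars <;>
      simp [hab, hab.symm] <;> grind
  rw [h4, congruenceJac_mul] at h3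
  have h5 := congruenceJac_mul_inv (S := Matrix.transvection a b c)
    (T := Matrix.transvection a b (-c)) (by
      rw [Matrix.transvection_mul_transvection_same _ _ hab, add_neg_cancel,
        Matrix.transvection_zero])
  have h6 : congruenceJac (Matrix.transvection a b c) ≠ 0 := left_ne_zero_of_mul_eq_one h5
  exact mul_left_cancel₀ h6 (h3.trans (mul_one _).symm)

/-- Coordinate swaps show that the position of `s` is immaterial. The product over all positions is
`s • 1`, with Jacobian `|s|^{2 d²}`, and a `d`-th root is taken. -/
theorem congruenceJac_diagonal_single (a : Fin d) (s : ℂ) :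
    congruenceJac (Matrix.diagonal (Function.update (1 : Fin d → ℂ) a s)) = (‖s‖ ^ 2) ^ d := by
  have h1 : ∀ b, congruenceJac (Matrix.diagonal (Function.update (1 : Fin d → ℂ) b s)) =
      congruenceJac (Matrix.diagonal (Function.update (1 : Fin d → ℂ) a s)) := by
    intro b
    have hS : (Equiv.swap a b).permMatrix ℂ * (Equiv.swap a b).permMatrix ℂ = 1 := by
      rw [← Matrix.permMatrix_mul, Equiv.swap_mul_self, Matrix.permMatrix_one]
    rw [← congruenceJac_conj hS (Matrix.diagonal (Function.update (1 : Fin d → ℂ) a s)),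
      Equiv.Perm.permMatrix, PEquiv.toMatrix_toPEquiv_mul, PEquiv.mul_toMatrix_toPEquiv,
      Matrix.submatrix_submatrix, Equiv.symm_swap, Function.comp_id, Function.id_comp,
      Matrix.submatrix_diagonal_equiv]
    congr 2
    ext i
    by_cases hi : i = b
    · subst hi; simp
    · have : Equiv.swap a b i ≠ a := by
        intro h
        rw [Equiv.swap_apply_eq_iff, Equiv.swap_apply_left] at h
        exact hi h
      simp [hi, this]
  have h2 : ∀ t : Finset (Fin d),
      congruenceJac (Matrix.diagonal (fun i => if i ∈ t then s else 1)) =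
      congruenceJac (Matrix.diagonal (Function.update (1 : Fin d → ℂ) a s)) ^ t.card := by
    intro t
    induction t using Finset.induction_on with
    | empty => simpa using congruenceJac_one
    | insert b t hb ih =>
      rw [Finset.card_insert_of_notMem hb, pow_succ, ← ih, ← h1 b, ← congruenceJac_mul,
        Matrix.diagonal_mul_diagonal]
      congr 2
      ext i
      by_cases hi : i = b
      · subst hi; simp [hb]
      · simp [hi]
  have h3 := h2 Finset.univ
  have h4 : Matrix.diagonal (fun i : Fin d => if i ∈ Finset.univ then s else 1) =
      s • (1 : Matrix (Fin d) (Fin d) ℂ) := by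
    simp [Matrix.smul_one_eq_diagonal]
  rw [h4, congruenceJac_smul_one, Finset.card_univ, Fintype.card_fin, sq d, pow_mul] at h3
  have hd : d ≠ 0 := by
    rintro rfl
    exact a.elim0
  exact ((pow_left_inj₀ (by positivity) (abs_nonneg _) hd).1 h3).symm

end HermitianSpace

/-! ### The positive cone, its radial decomposition and change of variables. -/

section Cone

open hermSpace MeasureTheory

variable {d : ℕ}

theorem hermSpace.continuous_mat_apply (i j : Fin d) :
    Continuous fun x : hermSpace d => mat x i j := by
  have h : Continuous fun x : HSSpace d => x (i, j) := by fun_prop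
  exact h.comp continuous_subtype_val

/-- The cone of positive semidefinite matrices. -/
def coneSet (d : ℕ) : Set (hermSpace d) := {x | (mat x).PosSemidef}

theorem isClosed_coneSet : IsClosed (coneSet d) := by
  have h : coneSet d = ⋂ w : Fin d → ℂ, {x | 0 ≤ star w ⬝ᵥ mat x *ᵥ w} := by
    ext x
    simp only [Set.mem_iInter]
    exact ⟨fun h w => h.dotProduct_mulVec_nonneg w, fun h =>
      Matrix.PosSemidef.of_dotProduct_mulVec_nonneg (isHermitian_mat x) h⟩
  rw [h]
  refine isClosed_iInter fun w => ?_
  have hc : Continuous fun x : hermSpace d => star w ⬝ᵥ mat x *ᵥ w := by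
    simp only [dotProduct, Matrix.mulVec]
    refine continuous_finsetSum _ fun i _ => continuous_const.mul ?_
    exact continuous_finsetSum _ fun j _ => (continuous_mat_apply i j).mul continuous_const
  exact isClosed_Ici.preimage hc

/-- With `A = B²`, an entry is a product of two rows of `B`, each of squared norm at most `tr A`.
The bound controls all integrands below. -/
theorem norm_apply_le_trace {A : Matrix (Fin d) (Fin d) ℂ} (hA : A.PosSemidef) (i j : Fin d) :
    ‖A i j‖ ≤ A.trace.re := by
  set B := cfc Real.sqrt A with hB
  have hBh : Bᴴ = B := matrix_cfc_conjTranspose _ _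
  have hBB : B * B = A := cfc_sqrt_mul_cfc_sqrt hA
  have htr : A.trace.re = ∑ i, ∑ j, ‖B i j‖ ^ 2 := by
    rw [← trace_mul_conjTranspose_re, hBh, hBB]
  have hij : ∀ i j, ‖B i j‖ = ‖B j i‖ := fun i j => by
    nth_rw 1 [← hBh]
    rw [Matrix.conjTranspose_apply, norm_star]
  have hrow : ∀ i, ∑ k, ‖B i k‖ ^ 2 ≤ A.trace.re := fun i => by
    rw [htr]
    exact Finset.single_le_sum (f := fun i => ∑ k, ‖B i k‖ ^ 2)
      (fun i _ => Finset.sum_nonneg fun k _ => by positivity) (Finset.mem_univ i)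
  have h1 : ‖A i j‖ ≤ ∑ k, (‖B i k‖ ^ 2 + ‖B j k‖ ^ 2) / 2 := by
    rw [← hBB, Matrix.mul_apply]
    refine (norm_sum_le _ _).trans (Finset.sum_le_sum fun k _ => ?_)
    rw [norm_mul, hij k j]
    nlinarith [sq_nonneg (‖B i k‖ - ‖B j k‖)]
  rw [← Finset.sum_div, Finset.sum_add_distrib] at h1
  linarith [hrow i, hrow j]

theorem trace_re_nonneg {A : Matrix (Fin d) (Fin d) ℂ} (hA : A.PosSemidef) : 0 ≤ A.trace.re :=
  (Complex.le_def.1 hA.trace_nonneg).1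

/-- The real vector space of traceless Hermitian matrices. -/
def tracelessSpace (d : ℕ) : Submodule ℝ (HSSpace d) where
  carrier := {x | x.toMatrix.IsHermitian ∧ x.toMatrix.trace = 0}
  add_mem' {x y} hx hy := by
    rw [Set.mem_ofPred_eq, HSSpace.toMatrix_add]
    exact ⟨Matrix.IsHermitian.add hx.1 hy.1, by rw [Matrix.trace_add, hx.2, hy.2, add_zero]⟩
  zero_mem' := ⟨Matrix.isHermitian_zero, Matrix.trace_zero _ _⟩
  smul_mem' c x hx := by
    rw [Set.mem_ofPred_eq] at *
    refine ⟨(hermSpace d).smul_mem c hx.1, ?_⟩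
    rw [HSSpace.toMatrix_smul, Matrix.trace_smul, hx.2, smul_zero]

/-- The maximally mixed state. -/
def maxMixed (d : ℕ) : hermSpace d :=
  mk ((d : ℂ)⁻¹ • 1) <| by
    rw [Matrix.IsHermitian, Matrix.conjTranspose_smul, Matrix.conjTranspose_one]
    simp

theorem mat_maxMixed : mat (maxMixed d) = (d : ℂ)⁻¹ • 1 := rfl

theorem trace_maxMixed (hd : 0 < d) : (mat (maxMixed d)).trace = 1 := by
  rw [mat_maxMixed, Matrix.trace_smul, Matrix.trace_one, Fintype.card_fin, smul_eq_mul,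
    inv_mul_cancel₀]
  exact_mod_cast hd.ne'

/-- A traceless Hermitian matrix as a Hermitian matrix. -/
def tracelessSpace.toHerm : tracelessSpace d →ₗ[ℝ] hermSpace d where
  toFun v := ⟨v, v.2.1⟩
  map_add' _ _ := rfl
  map_smul' _ _ := rfl

theorem trace_toHerm (v : tracelessSpace d) : (mat (tracelessSpace.toHerm v)).trace = 0 := v.2.2

/-- The decomposition of a Hermitian matrix into its trace and its traceless part. -/
def traceDecomp (hd : 0 < d) : (ℝ × tracelessSpace d) ≃ₗ[ℝ] hermSpace d where
  toFun p := p.1 • maxMixed d + tracelessSpace.toHerm p.2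
  map_add' p q := by
    simp only [Prod.fst_add, Prod.snd_add, add_smul, map_add]
    abel
  map_smul' c p := by
    simp only [Prod.smul_fst, Prod.smul_snd, map_smul, smul_add, RingHom.id_apply, smul_smul,
      smul_eq_mul]
  invFun x := ((mat x).trace.re, ⟨(x - (mat x).trace.re • maxMixed d : hermSpace d), by
    refine ⟨(x - (mat x).trace.re • maxMixed d : hermSpace d).2, ?_⟩
    change (mat x - (mat x).trace.re • mat (maxMixed d)).trace = 0
    rw [Matrix.trace_sub, Matrix.trace_smul, trace_maxMixed hd, Complex.real_smul, mul_one,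
      re_trace, sub_self]⟩)
  left_inv p := by
    have h : (mat (p.1 • maxMixed d + tracelessSpace.toHerm p.2)).trace.re = p.1 := by
      rw [mat_add, mat_smul, Matrix.trace_add, Matrix.trace_smul, trace_maxMixed hd, trace_toHerm]
      simp
    refine Prod.ext h (Subtype.ext ?_)
    simp only [h]
    rw [add_sub_cancel_left]
    rfl
  right_inv x := by
    apply Subtype.ext
    change (((mat x).trace.re • maxMixed d +
      (x - (mat x).trace.re • maxMixed d) : hermSpace d) : HSSpace d) = x
    rw [add_sub_cancel]

theorem traceDecomp_apply (hd : 0 < d) (p : ℝ × tracelessSpace d) :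
    traceDecomp hd p = p.1 • maxMixed d + tracelessSpace.toHerm p.2 := rfl

theorem trace_traceDecomp (hd : 0 < d) (p : ℝ × tracelessSpace d) :
    (mat (traceDecomp hd p)).trace.re = p.1 :=
  congrArg Prod.fst ((traceDecomp hd).symm_apply_apply p)

theorem traceDecomp_smul (hd : 0 < d) (t : ℝ) (u : tracelessSpace d) :
    traceDecomp hd (t, t • u) = t • traceDecomp hd (1, u) := by
  rw [← map_smul]
  simp

theorem finrank_tracelessSpace (hd : 0 < d) :
    Module.finrank ℝ (tracelessSpace d) = d ^ 2 - 1 := by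
  have h := (traceDecomp hd).finrank_eq
  rw [Module.finrank_prod, finrank_hermSpace, Module.finrank_self] at h
  omega

/-- The Hausdorff measure on the traceless Hermitian matrices. -/
def tracelessVolume (d : ℕ) : Measure (tracelessSpace d) := μH[(d : ℝ) ^ 2 - 1]

/-- The exponent of the Hausdorff measure is the dimension of the space; this makes the scaling and
linear substitution rules available. -/
theorem isAddHaarMeasure_tracelessVolume (hd : 0 < d) :
    (tracelessVolume d).IsAddHaarMeasure := by
  have h : (d : ℝ) ^ 2 - 1 = (Module.finrank ℝ (tracelessSpace d) : ℝ) := by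
    rw [finrank_tracelessSpace hd, Nat.cast_sub (Nat.one_le_pow _ _ hd)]
    push_cast
    ring
  rw [tracelessVolume, h]
  exact isAddHaarMeasure_hausdorffMeasure

/-- The volume on the Hermitian matrices. -/
def hermVolume (hd : 0 < d) : Measure (hermSpace d) :=
  (volume.prod (tracelessVolume d)).map (traceDecomp hd)

theorem continuous_traceDecomp (hd : 0 < d) : Continuous (traceDecomp hd) :=
  (traceDecomp hd).toContinuousLinearEquiv.continuous

theorem isAddHaarMeasure_hermVolume (hd : 0 < d) : (hermVolume hd).IsAddHaarMeasure := by
  have := isAddHaarMeasure_tracelessVolume hd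
  exact (traceDecomp hd).toContinuousLinearEquiv.isAddHaarMeasure_map _

/-- The density operators, as a subset of the traceless Hermitian matrices. -/
def densitySet (hd : 0 < d) : Set (tracelessSpace d) := {v | traceDecomp hd (1, v) ∈ coneSet d}

theorem isClosed_densitySet (hd : 0 < d) : IsClosed (densitySet hd) :=
  isClosed_coneSet.preimage ((continuous_traceDecomp hd).comp (by fun_prop))

theorem smul_mem_coneSet_iff {t : ℝ} (ht : 0 < t) (x : hermSpace d) :
    t • x ∈ coneSet d ↔ x ∈ coneSet d := by
  have key : ∀ {t : ℝ}, 0 < t → ∀ x ∈ coneSet d, t • x ∈ coneSet d := by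
    intro t ht x hx
    have h : (t : ℂ) • mat x = mat (t • x) := by
      ext i j
      simp [mat_smul]
    rw [coneSet, Set.mem_ofPred_eq, ← h]
    exact Matrix.PosSemidef.smul hx (by exact_mod_cast ht.le)
  refine ⟨fun h => ?_, key ht x⟩
  have := key (inv_pos.2 ht) _ h
  rwa [smul_smul, inv_mul_cancel₀ ht.ne', one_smul] at this

/-- The measure `t ^ N dt` on the positive half-line. -/
def radialMeasure (N : ℕ) : Measure ℝ :=
  (volume.restrict (Set.Ioi 0)).withDensity fun t => ENNReal.ofReal (t ^ N)

-- Polar coordinates `W = t σ`: the slice of the cone at trace `t > 0` is `t` times the slice at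
-- trace 1, and scaling in dimension `d² - 1` gives the weight `t^{d² - 1}`.
open scoped Pointwise in
theorem hermVolume_restrict_coneSet (hd : 0 < d) :
    (hermVolume hd).restrict (coneSet d) =
      ((radialMeasure (d ^ 2 - 1)).prod ((tracelessVolume d).restrict (densitySet hd))).map
        fun p => p.1 • traceDecomp hd (1, p.2) := by
  have := isAddHaarMeasure_tracelessVolume hd
  have hcd := continuous_traceDecomp hd
  have hmeas : Measurable fun p : ℝ × tracelessSpace d => p.1 • traceDecomp hd (1, p.2) :=
    (continuous_fst.smul (hcd.comp (by fun_prop))).measurable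
  refine Measure.ext fun s hs => ?_
  have hsC := hs.inter (isClosed_coneSet (d := d)).measurableSet
  rw [Measure.restrict_apply hs, hermVolume, Measure.map_apply hcd.measurable hsC,
    Measure.prod_apply (hcd.measurable hsC), Measure.map_apply hmeas hs,
    Measure.prod_apply (hmeas hs), radialMeasure,
    lintegral_withDensity_eq_lintegral_mul _ (by fun_prop) (measurable_measure_prodMk_left (hmeas hs)),
    ← lintegral_indicator measurableSet_Ioi]
  refine lintegral_congr_ae ?_
  have h0 : ∀ᵐ t : ℝ, t ≠ 0 := by
    simp [ae_iff]
  filter_upwards [h0] with t ht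
  rcases lt_or_gt_of_ne ht with h | h
  · rw [Set.indicator_of_notMem (by simpa using h.le)]
    suffices Prod.mk t ⁻¹' (⇑(traceDecomp hd) ⁻¹' (s ∩ coneSet d)) = ∅ by
      rw [this, measure_empty]
    ext v
    simp only [Set.mem_preimage, Set.mem_inter_iff, Set.mem_empty_iff_false, iff_false, not_and]
    intro _ hc
    have := trace_re_nonneg hc
    rw [trace_traceDecomp] at this
    exact absurd this (not_le.2 h)
  · rw [Set.indicator_of_mem (by simpa using h), Pi.mul_apply,
      Measure.restrict_apply (measurable_prodMk_left (hmeas hs))]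
    have h1 : Prod.mk t ⁻¹' (⇑(traceDecomp hd) ⁻¹' (s ∩ coneSet d)) =
        t • (Prod.mk t ⁻¹' ((fun p : ℝ × tracelessSpace d => p.1 • traceDecomp hd (1, p.2)) ⁻¹' s) ∩
          densitySet hd) := by
      ext v
      rw [Set.mem_smul_set_iff_inv_smul_mem₀ ht]
      have h2 : v = t • t⁻¹ • v := by rw [smul_smul, mul_inv_cancel₀ ht, one_smul]
      simp only [Set.mem_preimage, Set.mem_inter_iff, densitySet, Set.mem_ofPred_eq]
      nth_rw 1 [h2]
      nth_rw 2 [h2]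
      rw [traceDecomp_smul, smul_mem_coneSet_iff h]
    rw [h1, Measure.addHaar_smul, finrank_tracelessSpace hd, abs_of_nonneg (by positivity)]

/-- Congruence by an invertible matrix maps the cone onto itself, so this is the linear change of
variables for a Haar measure. -/
theorem integral_congruence (hd : 0 < d) {S T : Matrix (Fin d) (Fin d) ℂ} (hST : T * S = 1)
    (F : hermSpace d → ℂ) :
    (congruenceJac S : ℂ) * ∫ x in coneSet d, F (congruence S x) ∂(hermVolume hd) =
      ∫ x in coneSet d, F x ∂(hermVolume hd) := by
  have := isAddHaarMeasure_hermVolume hd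
  have hJ : congruenceJac S ≠ 0 :=
    right_ne_zero_of_mul_eq_one (congruenceJac_mul_inv hST)
  have hdet : LinearMap.det (congruence S) ≠ 0 := fun h => hJ (by rw [congruenceJac, h, abs_zero])
  have hTS : congruence T ∘ₗ congruence S = LinearMap.id := by
    rw [← congruence_mul, hST]
    ext1 x
    apply mat_injective
    rw [mat_congruence, Matrix.one_mul, Matrix.conjTranspose_one, Matrix.mul_one]
    rfl
  have hemb : MeasurableEmbedding (congruence S) :=
    (LinearMap.isClosedEmbedding_of_injective (LinearMap.ker_eq_bot_of_inverse hTS)).measurableEmbedding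
  have hcone : ∀ x, congruence S x ∈ coneSet d ↔ x ∈ coneSet d := by
    have key : ∀ (S : Matrix (Fin d) (Fin d) ℂ) x, x ∈ coneSet d → congruence S x ∈ coneSet d :=
      fun S x hx => Matrix.PosSemidef.mul_mul_conjTranspose_same hx S
    refine fun x => ⟨fun h => ?_, key S x⟩
    have := key T _ h
    rwa [← LinearMap.comp_apply, hTS] at this
  rw [← integral_indicator isClosed_coneSet.measurableSet,
    ← integral_indicator isClosed_coneSet.measurableSet]
  have h1 : (coneSet d).indicator (fun x => F (congruence S x)) =
      fun x => (coneSet d).indicator F (congruence S x) := by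
    ext x
    by_cases hx : x ∈ coneSet d
    · rw [Set.indicator_of_mem hx, Set.indicator_of_mem ((hcone x).2 hx)]
    · rw [Set.indicator_of_notMem hx, Set.indicator_of_notMem (mt (hcone x).1 hx)]
  rw [h1, ← hemb.integral_map, Measure.map_linearMap_addHaar_eq_smul_addHaar _ hdet,
    integral_smul_measure, ENNReal.toReal_ofReal (abs_nonneg _), abs_inv, Complex.real_smul,
    ← mul_assoc]
  change ((congruenceJac S : ℝ) : ℂ) * (((congruenceJac S)⁻¹ : ℝ) : ℂ) * _ = _
  rw [← Complex.ofReal_mul, mul_inv_cancel₀ hJ, Complex.ofReal_one, one_mul]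

end Cone

/-! ### Moments of the Hilbert–Schmidt measure as moments on the cone. -/

section DensityMoments

open hermSpace MeasureTheory

variable {d : ℕ}

theorem integral_pow_mul_exp_neg_Ioi (q : ℕ) {b : ℝ} (hb : 0 < b) :
    ∫ t in Set.Ioi (0 : ℝ), t ^ q * Real.exp (-(b * t)) = (1 / b) ^ (q + 1) * q.factorial := by
  have h := Real.integral_rpow_mul_exp_neg_mul_Ioi (a := (q : ℝ) + 1) (by positivity) hb
  rw [Real.Gamma_nat_eq_factorial, add_sub_cancel_right] at h
  simp only [Real.rpow_natCast] at h
  rw [h]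
  norm_cast

theorem integral_radialMeasure (N : ℕ) (g : ℝ → ℝ) :
    ∫ t, g t ∂(radialMeasure N) = ∫ t in Set.Ioi 0, t ^ N * g t := by
  have h : Measurable fun t : ℝ => (t ^ N).toNNReal := by fun_prop
  rw [radialMeasure]
  refine (integral_withDensity_eq_integral_smul h g).trans ?_
  refine setIntegral_congr_fun measurableSet_Ioi fun t ht => ?_
  change ((t ^ N).toNNReal : ℝ) * g t = _
  rw [Real.coe_toNNReal _ (pow_nonneg (le_of_lt ht) N)]

theorem integral_radialMeasure_pow_mul_exp (N q : ℕ) {b : ℝ} (hb : 0 < b) :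
    ∫ t, t ^ q * Real.exp (-(b * t)) ∂(radialMeasure N) =
      (1 / b) ^ (N + q + 1) * (N + q).factorial := by
  rw [integral_radialMeasure, ← integral_pow_mul_exp_neg_Ioi _ hb]
  refine setIntegral_congr_fun measurableSet_Ioi fun t _ => ?_
  simp only [pow_add, mul_assoc]

theorem integrable_radialMeasure_pow_mul_exp (N q : ℕ) {b : ℝ} (hb : 0 < b) :
    Integrable (fun t => t ^ q * Real.exp (-(b * t))) (radialMeasure N) := by
  -- The Bochner integral of a non-integrable function is 0, so a nonzero value proves
  -- integrability.
  refine .of_integral_ne_zero ?_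
  rw [integral_radialMeasure_pow_mul_exp N q hb]
  positivity

instance (N : ℕ) : SFinite (radialMeasure N) := by
  unfold radialMeasure
  infer_instance

theorem isCompact_densitySet (hd : 0 < d) : IsCompact (densitySet hd) := by
  refine Metric.isCompact_of_isClosed_isBounded (isClosed_densitySet hd) ?_
  rw [isBounded_iff_forall_norm_le]
  refine ⟨√(∑ _ : Fin d × Fin d, 1) + ‖maxMixed d‖, fun v hv => ?_⟩
  have h1 : ‖traceDecomp hd (1, v)‖ ≤ √(∑ _ : Fin d × Fin d, 1) := by
    change ‖(traceDecomp hd (1, v) : HSSpace d)‖ ≤ _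
    rw [EuclideanSpace.norm_eq]
    refine Real.sqrt_le_sqrt (Finset.sum_le_sum fun p _ => ?_)
    have h2 := norm_apply_le_trace hv p.1 p.2
    rw [trace_traceDecomp] at h2
    exact pow_le_one₀ (norm_nonneg _) h2
  have h2 : tracelessSpace.toHerm v = traceDecomp hd (1, v) - maxMixed d := by
    rw [traceDecomp_apply, one_smul, add_sub_cancel_left]
  have h3 : ‖v‖ = ‖tracelessSpace.toHerm v‖ := rfl
  rw [h3, h2]
  exact (norm_sub_le _ _).trans (by gcongr)

/-- If all entries of `V` are below `d⁻²`, then `|⟨w, V w⟩| ≤ d⁻² (∑ |w_i|)² ≤ d⁻¹ ‖w‖²`, which the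
maximally mixed part compensates. Hence the normalizing volume is positive. -/
theorem densitySet_mem_nhds (hd : 0 < d) : densitySet hd ∈ nhds (0 : tracelessSpace d) := by
  have hd' : (0 : ℝ) < d := by exact_mod_cast hd
  have hc : ∀ i j, Continuous fun v : tracelessSpace d =>
      ‖mat (tracelessSpace.toHerm v) i j‖ := fun i j =>
    ((continuous_mat_apply i j).comp tracelessSpace.toHerm.continuous_of_finiteDimensional).norm
  have h1 : ∀ᶠ v in nhds (0 : tracelessSpace d), ∀ i j,
      ‖mat (tracelessSpace.toHerm v) i j‖ < ((d : ℝ) ^ 2)⁻¹ := by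
    rw [Filter.eventually_all]
    intro i
    rw [Filter.eventually_all]
    intro j
    refine (hc i j).continuousAt.eventually_lt continuousAt_const ?_
    have : mat (tracelessSpace.toHerm (0 : tracelessSpace d)) i j = 0 := rfl
    rw [this, norm_zero]
    positivity
  filter_upwards [h1] with v hv
  refine Matrix.PosSemidef.of_dotProduct_mulVec_nonneg (isHermitian_mat _) fun w => ?_
  set V := mat (tracelessSpace.toHerm v) with hV
  have hsum : mat (traceDecomp hd (1, v)) = (d : ℂ)⁻¹ • 1 + V := by
    rw [traceDecomp_apply, one_smul, mat_add, mat_maxMixed]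
  have hVherm : Vᴴ = V := isHermitian_mat _
  have hself : star (star w ⬝ᵥ V *ᵥ w) = star w ⬝ᵥ V *ᵥ w := by
    rw [← Matrix.star_dotProduct_star, star_star, Matrix.star_mulVec, hVherm,
      ← Matrix.dotProduct_mulVec]
  have hre := Complex.conj_eq_iff_re.1 hself
  have hw : star w ⬝ᵥ w = ((∑ i, ‖w i‖ ^ 2 : ℝ) : ℂ) := by
    rw [dotProduct]
    push_cast
    simp only [← Complex.conj_mul']
    rfl
  have hbound : ‖star w ⬝ᵥ V *ᵥ w‖ ≤ ((d : ℝ) ^ 2)⁻¹ * (∑ i, ‖w i‖) ^ 2 := by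
    rw [sq (∑ i, ‖w i‖), Finset.sum_mul_sum, Finset.mul_sum, dotProduct]
    refine (norm_sum_le _ _).trans (Finset.sum_le_sum fun i _ => ?_)
    rw [Matrix.mulVec, dotProduct, Finset.mul_sum, Finset.mul_sum]
    refine (norm_sum_le _ _).trans (Finset.sum_le_sum fun j _ => ?_)
    rw [norm_mul, norm_mul, Pi.star_apply, norm_star]
    have := mul_le_mul_of_nonneg_right (hv i j).le
      (mul_nonneg (norm_nonneg (w i)) (norm_nonneg (w j)))
    linarith
  have hcs : (∑ i, ‖w i‖) ^ 2 ≤ d * ∑ i, ‖w i‖ ^ 2 := by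
    simpa using sq_sum_le_card_mul_sum_sq (s := Finset.univ) (f := fun i => ‖w i‖)
  rw [hsum, Matrix.add_mulVec, dotProduct_add, Matrix.smul_mulVec, dotProduct_smul,
    Matrix.one_mulVec, hw, ← hre, smul_eq_mul]
  have h4 : (0 : ℝ) ≤ (d : ℝ)⁻¹ * (∑ i, ‖w i‖ ^ 2) + (star w ⬝ᵥ V *ᵥ w).re := by
    have h5 := (abs_le.1 ((Complex.abs_re_le_norm _).trans hbound)).1
    have h6 : ((d : ℝ) ^ 2)⁻¹ * (∑ i, ‖w i‖) ^ 2 ≤ (d : ℝ)⁻¹ * ∑ i, ‖w i‖ ^ 2 := by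
      calc _ ≤ ((d : ℝ) ^ 2)⁻¹ * (d * ∑ i, ‖w i‖ ^ 2) := by gcongr
        _ = _ := by field_simp
    linarith
  have h7 := Complex.zero_le_real.2 h4
  rwa [Complex.ofReal_add, Complex.ofReal_mul, Complex.ofReal_inv, Complex.ofReal_natCast] at h7

/-- The `n`-fold moments of a density operator that is uniformly distributed for the volume of the
Hilbert–Schmidt metric, before normalization. -/
def densityMoment (hd : 0 < d) {n : ℕ} (i j : Fin n → Fin d) : ℂ :=
  ∫ v in densitySet hd, ∏ k, mat (traceDecomp hd (1, v)) (i k) (j k) ∂(tracelessVolume d)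

/-- The moments of the measure `e ^ (- tr W) dW` on the cone of positive semidefinite matrices. -/
def coneMoment (hd : 0 < d) {n : ℕ} (i j : Fin n → Fin d) : ℂ :=
  ∫ x in coneSet d, (∏ k, mat x (i k) (j k)) * (Real.exp (-(mat x).trace.re) : ℝ) ∂(hermVolume hd)

theorem measure_densitySet_lt_top (hd : 0 < d) : tracelessVolume d (densitySet hd) < ∞ := by
  have := isAddHaarMeasure_tracelessVolume hd
  exact (isCompact_densitySet hd).measure_lt_top

theorem measure_densitySet_pos (hd : 0 < d) : 0 < tracelessVolume d (densitySet hd) := by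
  have := isAddHaarMeasure_tracelessVolume hd
  exact MeasureTheory.Measure.measure_pos_of_mem_nhds _ (densitySet_mem_nhds hd)

theorem continuous_trace_re : Continuous fun x : hermSpace d => (mat x).trace.re := by
  refine Complex.continuous_re.comp ?_
  exact continuous_finsetSum _ fun i _ => continuous_mat_apply i i

theorem measurable_smul_traceDecomp (hd : 0 < d) :
    Measurable fun p : ℝ × tracelessSpace d => p.1 • traceDecomp hd (1, p.2) :=
  (continuous_fst.smul ((continuous_traceDecomp hd).comp (by fun_prop))).measurable

theorem trace_re_smul_traceDecomp (hd : 0 < d) (p : ℝ × tracelessSpace d) :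
    (mat (p.1 • traceDecomp hd (1, p.2))).trace.re = p.1 := by
  rw [← traceDecomp_smul, trace_traceDecomp]

/-- The product of entries is homogeneous of degree `n`, so the radial integral is `∫ t^{d² - 1 + n}
e^{-t} dt`. -/
theorem coneMoment_eq (hd : 0 < d) {n : ℕ} (i j : Fin n → Fin d) :
    coneMoment hd i j = ((d ^ 2 - 1 + n).factorial : ℂ) * densityMoment hd i j := by
  have := isAddHaarMeasure_tracelessVolume hd
  have hcont : Continuous fun x : hermSpace d =>
      (∏ k, mat x (i k) (j k)) * ((Real.exp (-(mat x).trace.re) : ℝ) : ℂ) := by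
    refine (continuous_finsetProd _ fun k _ => continuous_mat_apply _ _).mul ?_
    exact Complex.continuous_ofReal.comp (Real.continuous_exp.comp continuous_trace_re.neg)
  rw [coneMoment, hermVolume_restrict_coneSet, integral_map
    (measurable_smul_traceDecomp hd).aemeasurable hcont.aestronglyMeasurable]
  have h1 : ∀ p : ℝ × tracelessSpace d,
      (∏ k, mat (p.1 • traceDecomp hd (1, p.2)) (i k) (j k)) *
        ((Real.exp (-(mat (p.1 • traceDecomp hd (1, p.2))).trace.re) : ℝ) : ℂ) =
      ((p.1 ^ n * Real.exp (-(1 * p.1)) : ℝ) : ℂ) *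
        ∏ k, mat (traceDecomp hd (1, p.2)) (i k) (j k) := by
    intro p
    rw [trace_re_smul_traceDecomp]
    simp only [mat_smul, Matrix.smul_apply, Complex.real_smul, Finset.prod_mul_distrib,
      Finset.prod_const, Finset.card_univ, Fintype.card_fin]
    push_cast
    ring_nf
  simp only [h1]
  rw [integral_prod_mul (f := fun t : ℝ => ((t ^ n * Real.exp (-(1 * t)) : ℝ) : ℂ))
    (g := fun v => ∏ k, mat (traceDecomp hd (1, v)) (i k) (j k)), integral_complex_ofReal,
    integral_radialMeasure_pow_mul_exp _ _ one_pos, densityMoment]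
  simp

theorem integrableOn_coneSet_pow_mul_exp (hd : 0 < d) (q : ℕ) {b : ℝ} (hb : 0 < b) :
    Integrable (fun x => (mat x).trace.re ^ q * Real.exp (-(b * (mat x).trace.re)))
      ((hermVolume hd).restrict (coneSet d)) := by
  have := isAddHaarMeasure_tracelessVolume hd
  have : IsFiniteMeasure ((tracelessVolume d).restrict (densitySet hd)) :=
    ⟨by simpa using measure_densitySet_lt_top hd⟩
  have hcont : Continuous fun x : hermSpace d =>
      (mat x).trace.re ^ q * Real.exp (-(b * (mat x).trace.re)) := by
    have := continuous_trace_re (d := d)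
    fun_prop
  rw [hermVolume_restrict_coneSet, integrable_map_measure hcont.aestronglyMeasurable
    (measurable_smul_traceDecomp hd).aemeasurable]
  simp only [Function.comp_def, trace_re_smul_traceDecomp]
  simpa using (integrable_radialMeasure_pow_mul_exp (d ^ 2 - 1) q hb).mul_prod
    (integrable_const (1 : ℝ) (μ := (tracelessVolume d).restrict (densitySet hd)))

/-- The affine embedding of the traceless matrices as the matrices of trace one. -/
def traceOneEmbedding (hd : 0 < d) (v : tracelessSpace d) : HSSpace d :=
  (traceDecomp hd (1, v) : hermSpace d)

theorem isometry_traceOneEmbedding (hd : 0 < d) : Isometry (traceOneEmbedding hd) := by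
  have h : traceOneEmbedding hd = fun v : tracelessSpace d =>
      (maxMixed d : HSSpace d) + (v : HSSpace d) := by
    ext1 v
    rw [traceOneEmbedding, traceDecomp_apply, one_smul]
    rfl
  rw [h]
  exact (isometry_add_left _).comp isometry_subtype_coe

theorem traceOneEmbedding_preimage (hd : 0 < d) :
    traceOneEmbedding hd ⁻¹' densityOperators d = densitySet hd := by
  ext v
  refine ⟨fun h => h.1, fun h => ⟨h, ?_⟩⟩
  change (mat (traceDecomp hd (1, v))).trace = 1
  rw [← re_trace, trace_traceDecomp]
  simp

theorem densityOperators_subset_range (hd : 0 < d) :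
    densityOperators d ⊆ Set.range (traceOneEmbedding hd) := by
  intro x hx
  have h1 : (mat (⟨x, hx.1.isHermitian⟩ : hermSpace d)).trace.re = 1 := by
    change x.toMatrix.trace.re = 1
    rw [hx.2]
    simp
  have h2 := (traceDecomp hd).apply_symm_apply ⟨x, hx.1.isHermitian⟩
  refine ⟨((traceDecomp hd).symm ⟨x, hx.1.isHermitian⟩).2, ?_⟩
  have h3 : ((traceDecomp hd).symm ⟨x, hx.1.isHermitian⟩).1 = 1 := h1
  rw [traceOneEmbedding, ← h3, Prod.mk.eta, h2]

/-- Translation by the maximally mixed state is an isometry, hence carries Hausdorff measure to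
Hausdorff measure. -/
theorem hausdorffMeasure_restrict_densityOperators (hd : 0 < d) :
    (μH[(d : ℝ) ^ 2 - 1] : Measure (HSSpace d)).restrict (densityOperators d) =
      ((tracelessVolume d).restrict (densitySet hd)).map (traceOneEmbedding hd) := by
  have hiso := isometry_traceOneEmbedding hd
  have h1 : (1 : ℝ) ≤ d := by exact_mod_cast hd
  have h2 := hiso.map_hausdorffMeasure (d := (d : ℝ) ^ 2 - 1) (Or.inl (by nlinarith))
  rw [← Measure.restrict_restrict_of_subset (densityOperators_subset_range hd), ← h2,
    hiso.isClosedEmbedding.measurableEmbedding.restrict_map, traceOneEmbedding_preimage]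
  rfl

theorem deFinettiState_eq_densityMoment (hd : 0 < d) {n : ℕ} (i j : Fin n → Fin d) :
    deFinettiState n d i j =
      ((tracelessVolume d (densitySet hd)).toReal : ℂ)⁻¹ * densityMoment hd i j := by
  have hemb := (isometry_traceOneEmbedding hd).isClosedEmbedding.measurableEmbedding
  have h1 : (μH[(d : ℝ) ^ 2 - 1] : Measure (HSSpace d)) (densityOperators d) =
      tracelessVolume d (densitySet hd) := by
    rw [← Measure.restrict_apply_univ, hausdorffMeasure_restrict_densityOperators hd,
      hemb.map_apply, Set.preimage_univ, Measure.restrict_apply_univ]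
  rw [deFinettiState, Matrix.of_apply, hsMeasure, ProbabilityTheory.cond, integral_smul_measure,
    h1, hausdorffMeasure_restrict_densityOperators hd, hemb.integral_map, ENNReal.toReal_inv,
    Complex.real_smul, Complex.ofReal_inv]
  rfl

end DensityMoments

/-! ### Differentiation under the integral sign. -/

section Differentiation

open MeasureTheory

theorem hasDerivAt_quadratic (x y z : ℂ) (ε : ℝ) :
    HasDerivAt (fun ε : ℝ => x + ε * y + (ε : ℂ) ^ 2 * z) (y + 2 * ε * z) ε := by
  have h1 : HasDerivAt (fun ε : ℝ => (ε : ℂ)) 1 ε := Complex.ofRealCLM.hasDerivAt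
  have h2 := ((h1.mul_const y).const_add x).add ((h1.pow 2).mul_const z)
  refine (h2.congr_deriv ?_)
  push_cast
  ring

theorem hasDerivAt_exp_neg_quadratic (T y z ε : ℝ) :
    HasDerivAt (fun ε : ℝ => ((Real.exp (-(T + ε * y + ε ^ 2 * z)) : ℝ) : ℂ))
      ((Real.exp (-(T + ε * y + ε ^ 2 * z)) * (-(y + 2 * ε * z)) : ℝ) : ℂ) ε := by
  have h1 : HasDerivAt (fun ε : ℝ => ε) 1 ε := hasDerivAt_id ε
  have h2 : HasDerivAt (fun ε : ℝ => -(T + ε * y + ε ^ 2 * z)) (-(y + 2 * ε * z)) ε :=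
    (((h1.mul_const y).const_add T).add ((h1.pow 2).mul_const z)).neg.congr_deriv (by
      push_cast
      ring)
  exact h2.exp.ofReal_comp

theorem norm_add_mul_add_sq_mul_le {x y z : ℂ} {B ε : ℝ} (hε : |ε| ≤ 1) (hx : ‖x‖ ≤ B)
    (hy : ‖y‖ ≤ B) (hz : ‖z‖ ≤ B) : ‖x + ε * y + (ε : ℂ) ^ 2 * z‖ ≤ 3 * B := by
  have hB : 0 ≤ B := (norm_nonneg x).trans hx
  have h1 : ‖(ε : ℂ) * y‖ ≤ B := by
    rw [norm_mul, Complex.norm_real, Real.norm_eq_abs]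
    nlinarith [abs_nonneg ε, norm_nonneg y]
  have h2 : ‖(ε : ℂ) ^ 2 * z‖ ≤ B := by
    rw [norm_mul, norm_pow, Complex.norm_real, Real.norm_eq_abs]
    have : |ε| ^ 2 ≤ 1 := pow_le_one₀ (abs_nonneg _) hε
    nlinarith [norm_nonneg z, sq_nonneg |ε|]
  exact (norm_add₃_le).trans (by linarith)

theorem hasDerivAt_integral_prod_mul_exp {X : Type*} [MeasurableSpace X] {ν : Measure X} {n : ℕ}
    {x y z : Fin n → X → ℂ} {T y₀ z₀ : X → ℝ} {K : ℝ} (hK : 1 ≤ K)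
    (hx : ∀ k, Measurable (x k)) (hy : ∀ k, Measurable (y k)) (hz : ∀ k, Measurable (z k))
    (hT : Measurable T) (hy₀ : Measurable y₀) (hz₀ : Measurable z₀)
    (hT0 : ∀ᵐ a ∂ν, 0 ≤ T a)
    (hb : ∀ᵐ a ∂ν, ∀ k, ‖x k a‖ ≤ K * T a ∧ ‖y k a‖ ≤ K * T a ∧ ‖z k a‖ ≤ K * T a)
    (hb₀ : ∀ᵐ a ∂ν, |y₀ a| ≤ K * T a ∧ 0 ≤ z₀ a ∧ z₀ a ≤ K * T a)
    (hint : ∀ q : ℕ, Integrable (fun a => T a ^ q * Real.exp (-(1 / 2 * T a))) ν) :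
    HasDerivAt (fun ε : ℝ => ∫ a, (∏ k, (x k a + ε * y k a + (ε : ℂ) ^ 2 * z k a)) *
        ((Real.exp (-(T a + ε * y₀ a + ε ^ 2 * z₀ a)) : ℝ) : ℂ) ∂ν)
      (∫ a, ((∑ k, (∏ l ∈ Finset.univ.erase k, x l a) * y k a) - (∏ k, x k a) * y₀ a) *
        ((Real.exp (-T a) : ℝ) : ℂ) ∂ν) 0 := by
  let F : ℝ → X → ℂ := fun ε a => (∏ k, (x k a + ε * y k a + (ε : ℂ) ^ 2 * z k a)) *
    ((Real.exp (-(T a + ε * y₀ a + ε ^ 2 * z₀ a)) : ℝ) : ℂ)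
  let F' : ℝ → X → ℂ := fun ε a =>
    (∑ k, (∏ l ∈ Finset.univ.erase k, (x l a + ε * y l a + (ε : ℂ) ^ 2 * z l a)) •
      (y k a + 2 * ε * z k a)) * ((Real.exp (-(T a + ε * y₀ a + ε ^ 2 * z₀ a)) : ℝ) : ℂ) +
    (∏ k, (x k a + ε * y k a + (ε : ℂ) ^ 2 * z k a)) *
      ((Real.exp (-(T a + ε * y₀ a + ε ^ 2 * z₀ a)) * (-(y₀ a + 2 * ε * z₀ a)) : ℝ) : ℂ)
  -- The exponent `n - 1 + 1` counts the undifferentiated factors and the differentiated one. For `n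
  -- = 0` it is 1 by truncated subtraction, but the coefficient `n` kills the term.
  let bound : X → ℝ := fun a =>
    (n * (3 * K) ^ (n - 1 + 1)) * (T a ^ (n - 1 + 1) * Real.exp (-(1 / 2 * T a))) +
      (3 * K) ^ (n + 1) * (T a ^ (n + 1) * Real.exp (-(1 / 2 * T a)))
  have hFm : ∀ ε, Measurable (F ε) := fun ε => by
    refine (Finset.measurable_fun_prod _ fun k _ => ?_).mul ?_
    · have := hx k; have := hy k; have := hz k
      fun_prop
    · fun_prop
  have hF'm : ∀ ε, Measurable (F' ε) := fun ε => by
    have hq : ∀ s : Finset (Fin n), Measurable fun a =>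
        ∏ k ∈ s, (x k a + ε * y k a + (ε : ℂ) ^ 2 * z k a) := fun s =>
      Finset.measurable_fun_prod _ fun k _ => by
        have := hx k; have := hy k; have := hz k
        fun_prop
    have hs : Measurable fun a => ∑ k, (∏ l ∈ Finset.univ.erase k,
        (x l a + ε * y l a + (ε : ℂ) ^ 2 * z l a)) • (y k a + 2 * ε * z k a) :=
      Finset.measurable_fun_sum _ fun k _ => by
        have := hq (Finset.univ.erase k); have := hy k; have := hz k
        fun_prop
    have := hq Finset.univ
    fun_prop
  have hK0 : 0 < K := by linarith
  have hδ : 0 < 1 / (2 * K) := by positivity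
  -- The radius `1 / (2K)` keeps the linear term of the exponent below `T / 2`; the quadratic term
  -- has the favourable sign because `z₀ ≥ 0`.
  have hexp : ∀ᵐ a ∂ν, ∀ ε ∈ Metric.ball (0 : ℝ) (1 / (2 * K)),
      Real.exp (-(T a + ε * y₀ a + ε ^ 2 * z₀ a)) ≤ Real.exp (-(1 / 2 * T a)) := by
    filter_upwards [hT0, hb₀] with a ha hba ε hε
    rw [mem_ball_zero_iff, Real.norm_eq_abs] at hε
    refine Real.exp_le_exp.2 (neg_le_neg ?_)
    have h1 : |ε * y₀ a| ≤ 1 / 2 * T a := by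
      rw [abs_mul]
      calc |ε| * |y₀ a| ≤ 1 / (2 * K) * (K * T a) :=
            mul_le_mul hε.le hba.1 (abs_nonneg _) hδ.le
        _ = 1 / 2 * T a := by field_simp
    have h2 := (abs_le.1 h1).1
    have h3 : 0 ≤ ε ^ 2 * z₀ a := mul_nonneg (sq_nonneg _) hba.2.1
    linarith
  have hball : ∀ ε ∈ Metric.ball (0 : ℝ) (1 / (2 * K)), |ε| ≤ 1 / 2 := by
    intro ε hε
    rw [mem_ball_zero_iff, Real.norm_eq_abs] at hε
    refine hε.le.trans ?_
    rw [div_le_div_iff₀ (by positivity) two_pos]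
    linarith
  have hprod : ∀ᵐ a ∂ν, ∀ ε ∈ Metric.ball (0 : ℝ) (1 / (2 * K)), ∀ s : Finset (Fin n),
      ‖∏ k ∈ s, (x k a + ε * y k a + (ε : ℂ) ^ 2 * z k a)‖ ≤ (3 * K * T a) ^ s.card := by
    filter_upwards [hb] with a hba ε hε s
    rw [norm_prod]
    refine (Finset.prod_le_prod (fun _ _ => norm_nonneg _) fun k _ => ?_).trans_eq
      (Finset.prod_const (3 * K * T a))
    have := norm_add_mul_add_sq_mul_le ((hball ε hε).trans (by norm_num)) (hba k).1 (hba k).2.1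
      (hba k).2.2
    linarith
  have h0 : (0 : ℝ) ∈ Metric.ball (0 : ℝ) (1 / (2 * K)) := Metric.mem_ball_self hδ
  have hF0 : Integrable (F 0) ν := by
    refine ((hint n).const_mul ((3 * K) ^ n)).mono' (hFm 0).aestronglyMeasurable ?_
    filter_upwards [hexp, hprod] with a h1 h2
    have h3 := h2 0 h0 Finset.univ
    rw [Finset.card_univ, Fintype.card_fin, mul_pow] at h3
    rw [norm_mul, Complex.norm_real, Real.norm_of_nonneg (Real.exp_pos _).le, ← mul_assoc]
    exact mul_le_mul h3 (h1 0 h0) (Real.exp_pos _).le ((norm_nonneg _).trans h3)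
  have hbound : ∀ᵐ a ∂ν, ∀ ε ∈ Metric.ball (0 : ℝ) (1 / (2 * K)), ‖F' ε a‖ ≤ bound a := by
    filter_upwards [hexp, hprod, hT0, hb, hb₀] with a h1 h2 h3 h4 h5 ε hε
    have hE := h1 ε hε
    have hε2 := hball ε hε
    set E := Real.exp (-(T a + ε * y₀ a + ε ^ 2 * z₀ a)) with hEdef
    have hE0 : 0 ≤ E := (Real.exp_pos _).le
    have hKT : 0 ≤ 3 * K * T a := by positivity
    have hq' : ∀ k, ‖y k a + 2 * ε * z k a‖ ≤ 3 * K * T a := by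
      intro k
      have h6 : ‖2 * (ε : ℂ) * z k a‖ ≤ K * T a := by
        rw [norm_mul, norm_mul, Complex.norm_real, Real.norm_eq_abs, Complex.norm_ofNat]
        nlinarith [(h4 k).2.2, norm_nonneg (z k a), abs_nonneg ε]
      have h7 := (h4 k).2.1
      have h8 : 0 ≤ K * T a := by positivity
      exact (norm_add_le _ _).trans (by linarith)
    have h6 : ‖∑ k, (∏ l ∈ Finset.univ.erase k, (x l a + ε * y l a + (ε : ℂ) ^ 2 * z l a)) •
        (y k a + 2 * ε * z k a)‖ ≤ n * (3 * K * T a) ^ (n - 1 + 1) := by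
      refine (norm_sum_le_of_le _ (f := fun k => _)
        (n := fun _ => (3 * K * T a) ^ (n - 1 + 1)) fun k _ => ?_).trans (by simp)
      rw [norm_smul, pow_succ]
      have h7 := h2 ε hε (Finset.univ.erase k)
      rw [Finset.card_erase_of_mem (Finset.mem_univ k), Finset.card_univ, Fintype.card_fin] at h7
      exact mul_le_mul h7 (hq' k) (norm_nonneg _) (pow_nonneg hKT _)
    have h7 : |y₀ a + 2 * ε * z₀ a| ≤ 3 * K * T a := by
      have h8 : |2 * ε * z₀ a| ≤ K * T a := by
        rw [abs_mul, abs_mul, abs_of_nonneg h5.2.1, abs_two]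
        nlinarith [abs_nonneg ε]
      have h9 : 0 ≤ K * T a := by positivity
      exact (abs_add_le _ _).trans (by linarith [h5.1])
    have h8 := h2 ε hε Finset.univ
    rw [Finset.card_univ, Fintype.card_fin] at h8
    refine (norm_add_le _ _).trans (add_le_add ?_ ?_)
    · rw [norm_mul, Complex.norm_real, Real.norm_of_nonneg hE0, ← mul_assoc, mul_assoc (n : ℝ),
        ← mul_pow]
      exact mul_le_mul h6 hE hE0 (by positivity)
    · rw [norm_mul, Complex.norm_real, norm_mul, Real.norm_of_nonneg hE0, Real.norm_eq_abs, abs_neg]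
      calc _ ≤ (3 * K * T a) ^ n * (Real.exp (-(1 / 2 * T a)) * (3 * K * T a)) :=
            mul_le_mul h8 (mul_le_mul hE h7 (abs_nonneg _) (Real.exp_pos _).le)
              (mul_nonneg hE0 (abs_nonneg _)) (pow_nonneg hKT _)
        _ = _ := by ring
  have hbi : Integrable bound ν := ((hint _).const_mul _).add ((hint _).const_mul _)
  have hdiff : ∀ᵐ a ∂ν, ∀ ε ∈ Metric.ball (0 : ℝ) (1 / (2 * K)),
      HasDerivAt (F · a) (F' ε a) ε := by
    refine Filter.Eventually.of_forall fun a ε _ => ?_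
    exact (HasDerivAt.fun_finsetProd fun k _ => hasDerivAt_quadratic (x k a) (y k a) (z k a) ε).mul
      (hasDerivAt_exp_neg_quadratic (T a) (y₀ a) (z₀ a) ε)
  have h := (hasDerivAt_integral_of_dominated_loc_of_deriv_le (Metric.ball_mem_nhds 0 hδ)
    (Filter.Eventually.of_forall fun ε => (hFm ε).aestronglyMeasurable) hF0
    (hF'm 0).aestronglyMeasurable hbound hbi hdiff).2
  refine h.congr_deriv (integral_congr_ae (Filter.Eventually.of_forall fun a => ?_))
  simp only [F', smul_eq_mul]
  push_cast
  simp only [zero_mul, mul_zero, add_zero, ne_eq, OfNat.ofNat_ne_zero, not_false_eq_true, zero_pow]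
  ring

end Differentiation

/-! ### The moment recursion and the formula for the de Finetti state. -/

section MomentRecursion

open hermSpace MeasureTheory

variable {d : ℕ}

theorem congruence_one_add_apply (A : Matrix (Fin d) (Fin d) ℂ) (ε : ℝ) (x : hermSpace d)
    (i j : Fin d) :
    mat (congruence (1 + (ε : ℂ) • A) x) i j =
      mat x i j + ε * (A * mat x + mat x * Aᴴ) i j + (ε : ℂ) ^ 2 * (A * mat x * Aᴴ) i j := by
  have h : mat (congruence (1 + (ε : ℂ) • A) x) =
      mat x + (ε : ℂ) • (A * mat x + mat x * Aᴴ) + ((ε : ℂ) ^ 2) • (A * mat x * Aᴴ) := by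
    rw [mat_congruence, Matrix.conjTranspose_add, Matrix.conjTranspose_one,
      Matrix.conjTranspose_smul, Complex.star_def, Complex.conj_ofReal]
    simp only [Matrix.add_mul, Matrix.mul_add, Matrix.one_mul, Matrix.mul_one, Matrix.smul_mul,
      Matrix.mul_smul, smul_add, smul_smul, sq]
    abel
  rw [h]
  rfl

theorem trace_congruence_one_add (A : Matrix (Fin d) (Fin d) ℂ) (ε : ℝ) (x : hermSpace d) :
    (mat (congruence (1 + (ε : ℂ) • A) x)).trace.re =
      (mat x).trace.re + ε * (A * mat x + mat x * Aᴴ).trace.re +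
        ε ^ 2 * (A * mat x * Aᴴ).trace.re := by
  simp only [Matrix.trace, Matrix.diag_apply, congruence_one_add_apply, Finset.sum_add_distrib,
    ← Finset.mul_sum]
  rw [← Complex.ofReal_pow, Complex.add_re, Complex.add_re, Complex.re_ofReal_mul,
    Complex.re_ofReal_mul]

theorem single_mul_add_mul_apply (a b : Fin d) (c : ℂ) (X : Matrix (Fin d) (Fin d) ℂ)
    (i j : Fin d) :
    (Matrix.single a b c * X + X * (Matrix.single a b c)ᴴ) i j =
      (if i = a then c * X b j else 0) + (if j = a then star c * X i b else 0) := by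
  rw [Matrix.add_apply, Matrix.conjTranspose_single]
  congr 1
  · split_ifs with h
    · subst h; simp
    · exact Matrix.single_mul_apply_of_ne (h := h) ..
  · split_ifs with h
    · subst h; simp [mul_comm]
    · exact Matrix.mul_single_apply_of_ne (hbj := h) ..

theorem trace_single_mul_add_mul (a b : Fin d) (c : ℂ) (X : Matrix (Fin d) (Fin d) ℂ) :
    (Matrix.single a b c * X + X * (Matrix.single a b c)ᴴ).trace =
      c * X b a + star c * X a b := by
  simp only [Matrix.trace, Matrix.diag_apply, single_mul_add_mul_apply, Finset.sum_add_distrib,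
    Finset.sum_ite_eq', Finset.mem_univ, if_true]

theorem single_mul_mul_apply (a b : Fin d) (c : ℂ) (X : Matrix (Fin d) (Fin d) ℂ) (i j : Fin d) :
    (Matrix.single a b c * X * (Matrix.single a b c)ᴴ) i j =
      if i = a ∧ j = a then c * star c * X b b else 0 := by
  rw [Matrix.conjTranspose_single]
  by_cases hj : j = a
  · subst hj
    rw [Matrix.mul_single_apply_same]
    by_cases hi : i = j
    · subst hi
      simp
      ring
    · rw [Matrix.single_mul_apply_of_ne (h := hi)]
      simp [hi]
  · rw [Matrix.mul_single_apply_of_ne (hbj := hj)]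
    simp [hj]

theorem prod_erase_mul_update {n : ℕ} (X : Matrix (Fin d) (Fin d) ℂ) (i j : Fin n → Fin d)
    (k : Fin n) (b : Fin d) :
    (∏ l ∈ Finset.univ.erase k, X (i l) (j l)) * X b (j k) =
      ∏ l, X (Function.update i k b l) (j l) := by
  rw [← Finset.prod_erase_mul _ _ (Finset.mem_univ k), Function.update_self]
  congr 1
  refine Finset.prod_congr rfl fun l hl => ?_
  rw [Function.update_of_ne (Finset.ne_of_mem_erase hl)]

theorem prod_erase_mul_update_right {n : ℕ} (X : Matrix (Fin d) (Fin d) ℂ) (i j : Fin n → Fin d)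
    (k : Fin n) (b : Fin d) :
    (∏ l ∈ Finset.univ.erase k, X (i l) (j l)) * X (i k) b =
      ∏ l, X (i l) (Function.update j k b l) := by
  rw [← Finset.prod_erase_mul _ _ (Finset.mem_univ k), Function.update_self]
  congr 1
  refine Finset.prod_congr rfl fun l hl => ?_
  rw [Function.update_of_ne (Finset.ne_of_mem_erase hl)]

theorem measurable_mat_apply (i j : Fin d) : Measurable fun x : hermSpace d => mat x i j :=
  (continuous_mat_apply i j).measurable

theorem ae_mem_coneSet (hd : 0 < d) :
    ∀ᵐ x ∂(hermVolume hd).restrict (coneSet d), x ∈ coneSet d :=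
  ae_restrict_mem isClosed_coneSet.measurableSet

/-- The first variation of the moments under the congruences `1 + ε c E_{ab}`. -/
theorem hasDerivAt_coneMoment_congruence (hd : 0 < d) {n : ℕ} (i j : Fin n → Fin d) (a b : Fin d)
    (c : ℂ) :
    HasDerivAt (fun ε : ℝ => ∫ x in coneSet d,
        (∏ k, mat (congruence (1 + (ε : ℂ) • Matrix.single a b c) x) (i k) (j k)) *
          ((Real.exp (-(mat (congruence (1 + (ε : ℂ) • Matrix.single a b c) x)).trace.re) : ℝ) : ℂ)
        ∂(hermVolume hd))
      (∫ x in coneSet d, ((∑ k, (∏ l ∈ Finset.univ.erase k, mat x (i l) (j l)) *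
          ((if i k = a then c * mat x b (j k) else 0) +
            (if j k = a then star c * mat x (i k) b else 0))) -
          (∏ k, mat x (i k) (j k)) * (c * mat x b a + star c * mat x a b)) *
        ((Real.exp (-(mat x).trace.re) : ℝ) : ℂ) ∂(hermVolume hd)) 0 := by
  simp only [congruence_one_add_apply, trace_congruence_one_add]
  have hreal : ∀ x : hermSpace d,
      (((Matrix.single a b c * mat x + mat x * (Matrix.single a b c)ᴴ).trace.re : ℝ) : ℂ) =
        c * mat x b a + star c * mat x a b := by
    intro x
    have h1 : star (mat x b a) = mat x a b := by
      rw [← Matrix.conjTranspose_apply, (isHermitian_mat x).eq]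
    rw [trace_single_mul_add_mul]
    refine Complex.conj_eq_iff_re.1 ?_
    change star _ = _
    rw [star_add, star_mul', star_mul', star_star, h1, ← h1, star_star, add_comm]
  simp only [← hreal, ← single_mul_add_mul_apply]
  have hc := norm_nonneg c
  have hmA : ∀ i j, Measurable fun x : hermSpace d =>
      (Matrix.single a b c * mat x + mat x * (Matrix.single a b c)ᴴ) i j := by
    intro i j
    simp only [single_mul_add_mul_apply]
    have := fun i j => measurable_mat_apply (d := d) i j
    split_ifs <;> fun_prop
  have hmB : ∀ i j, Measurable fun x : hermSpace d =>
      (Matrix.single a b c * mat x * (Matrix.single a b c)ᴴ) i j := by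
    intro i j
    simp only [single_mul_mul_apply]
    have := fun i j => measurable_mat_apply (d := d) i j
    split_ifs <;> fun_prop
  have htr : ∀ {f : hermSpace d → Matrix (Fin d) (Fin d) ℂ},
      (∀ i j, Measurable fun x => f x i j) → Measurable fun x => (f x).trace.re := fun hf =>
    Complex.measurable_re.comp (Finset.measurable_fun_sum _ fun i _ => hf i i)
  have htrB : ∀ x : hermSpace d,
      (Matrix.single a b c * mat x * (Matrix.single a b c)ᴴ).trace.re =
        ‖c‖ ^ 2 * (mat x b b).re := by
    intro x
    have : (Matrix.single a b c * mat x * (Matrix.single a b c)ᴴ).trace =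
        c * star c * mat x b b := by
      simp only [Matrix.trace, Matrix.diag_apply, single_mul_mul_apply, and_self,
        Finset.sum_ite_eq', Finset.mem_univ, if_true]
    rw [this, Complex.star_def, Complex.mul_conj', ← Complex.ofReal_pow, Complex.re_ofReal_mul]
  -- With `A = c E_{ab}`, the entries of `W`, `A W + W Aᴴ` and `A W Aᴴ` are at most `1`, `2 ‖c‖` and
  -- `‖c‖²` times `tr W`; the sum serves for all three.
  have hK : 1 ≤ 1 + 2 * ‖c‖ + ‖c‖ ^ 2 := by nlinarith
  refine hasDerivAt_integral_prod_mul_exp (K := 1 + 2 * ‖c‖ + ‖c‖ ^ 2) hK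
    (fun k => measurable_mat_apply _ _) (fun k => hmA _ _) (fun k => hmB _ _)
    (htr measurable_mat_apply) (htr hmA) (htr hmB) ?_ ?_ ?_
    (fun q => integrableOn_coneSet_pow_mul_exp hd q (by norm_num))
  · filter_upwards [ae_mem_coneSet hd] with x hx
    exact trace_re_nonneg hx
  · filter_upwards [ae_mem_coneSet hd] with x hx k
    have hT := trace_re_nonneg hx
    have hle := norm_apply_le_trace hx
    set T := (mat x).trace.re
    have h1 : ∀ i j, ‖c * mat x i j‖ ≤ ‖c‖ * T := fun i j => by
      rw [norm_mul]; exact mul_le_mul_of_nonneg_left (hle i j) hc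
    have h2 : ∀ i j, ‖star c * mat x i j‖ ≤ ‖c‖ * T := fun i j => by
      rw [norm_mul, norm_star]; exact mul_le_mul_of_nonneg_left (hle i j) hc
    have h0 : 0 ≤ ‖c‖ * T := mul_nonneg hc hT
    have h0' : 0 ≤ ‖c‖ ^ 2 * T := by positivity
    refine ⟨?_, ?_, ?_⟩
    · nlinarith [hle (i k) (j k)]
    · rw [single_mul_add_mul_apply]
      refine (norm_add_le _ _).trans ?_
      have h3 : ‖if i k = a then c * mat x b (j k) else 0‖ ≤ ‖c‖ * T := by
        split_ifs
        · exact h1 _ _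
        · simpa using h0
      have h4 : ‖if j k = a then star c * mat x (i k) b else 0‖ ≤ ‖c‖ * T := by
        split_ifs
        · exact h2 _ _
        · simpa using h0
      nlinarith
    · rw [single_mul_mul_apply]
      split_ifs
      · rw [norm_mul, norm_mul, norm_star]
        have := mul_le_mul_of_nonneg_left (hle b b) (sq_nonneg ‖c‖)
        nlinarith
      · rw [norm_zero]
        positivity
  · filter_upwards [ae_mem_coneSet hd] with x hx
    have hT := trace_re_nonneg hx
    have hle := norm_apply_le_trace hx
    set T := (mat x).trace.re
    have h0 : 0 ≤ ‖c‖ * T := mul_nonneg hc hT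
    have h0' : 0 ≤ ‖c‖ ^ 2 * T := by positivity
    have hbb : 0 ≤ (mat x b b).re := (Complex.le_def.1 (Matrix.PosSemidef.diag_nonneg hx)).1
    refine ⟨?_, ?_, ?_⟩
    · rw [trace_single_mul_add_mul]
      refine (Complex.abs_re_le_norm _).trans ((norm_add_le _ _).trans ?_)
      rw [norm_mul, norm_mul, norm_star]
      have h1 := mul_le_mul_of_nonneg_left (hle b a) hc
      have h2 := mul_le_mul_of_nonneg_left (hle a b) hc
      nlinarith
    · rw [htrB]
      positivity
    · rw [htrB]
      have h3 := mul_le_mul_of_nonneg_left ((Complex.re_le_norm _).trans (hle b b)) (sq_nonneg ‖c‖)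
      nlinarith

/-- For `a = b` the Jacobian is `|1 + ε c|^{2d}`; for `a ≠ b` the matrix is a transvection and the
Jacobian is constant. -/
theorem hasDerivAt_congruenceJac (a b : Fin d) (c : ℂ) :
    HasDerivAt (fun ε : ℝ => (congruenceJac (1 + (ε : ℂ) • Matrix.single a b c) : ℂ))
      (if a = b then (d : ℂ) * (c + star c) else 0) 0 := by
  by_cases hab : a = b
  · subst hab
    rw [if_pos rfl]
    have h1 : ∀ ε : ℝ, congruenceJac (1 + (ε : ℂ) • Matrix.single a a c) =
        ((1 + ε * c.re) ^ 2 + (ε * c.im) ^ 2) ^ d := by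
      intro ε
      have h2 : (1 : Matrix (Fin d) (Fin d) ℂ) + (ε : ℂ) • Matrix.single a a c =
          Matrix.diagonal (Function.update (1 : Fin d → ℂ) a (1 + ε * c)) := by
        ext i j
        rw [Matrix.add_apply, Matrix.smul_apply, Matrix.one_apply, Matrix.single_apply,
          Matrix.diagonal_apply]
        by_cases hij : i = j
        · subst hij
          by_cases hi : i = a
          · subst hi; simp
          · simp [hi, Ne.symm hi]
        · by_cases hi : a = i
          · subst hi; simp [hij]
          · simp [hij, hi]
      rw [h2, congruenceJac_diagonal_single, ← Complex.normSq_eq_norm_sq, Complex.normSq_apply]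
      simp
      ring
    simp only [h1]
    have h0 : HasDerivAt (fun ε : ℝ => ε) 1 0 := hasDerivAt_id 0
    have h3 : HasDerivAt (fun ε : ℝ => ((1 + ε * c.re) ^ 2 + (ε * c.im) ^ 2) ^ d)
        (2 * d * c.re) 0 := by
      refine (((((h0.mul_const c.re).const_add 1).pow 2).add
        ((h0.mul_const c.im).pow 2)).pow d).congr_deriv ?_
      simp
      ring
    refine h3.ofReal_comp.congr_deriv ?_
    rw [Complex.star_def, Complex.add_conj]
    push_cast
    ring
  · rw [if_neg hab]
    have h1 : ∀ ε : ℝ, congruenceJac (1 + (ε : ℂ) • Matrix.single a b c) = 1 := by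
      intro ε
      rw [Matrix.smul_single]
      exact congruenceJac_transvection hab _
    simp only [h1]
    exact hasDerivAt_const _ _

theorem eventually_exists_inv (A : Matrix (Fin d) (Fin d) ℂ) :
    ∀ᶠ ε : ℝ in nhds 0, ∃ T, T * (1 + (ε : ℂ) • A) = 1 := by
  have h1 : Continuous fun ε : ℝ => (1 + (ε : ℂ) • A).det := by
    refine Continuous.matrix_det ?_
    exact continuous_const.add (Complex.continuous_ofReal.smul continuous_const)
  have h2 : (1 + ((0 : ℝ) : ℂ) • A).det ≠ 0 := by simp
  filter_upwards [h1.continuousAt.eventually_ne h2] with ε hε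
  exact ⟨_, Matrix.nonsing_inv_mul _ (isUnit_iff_ne_zero.2 hε)⟩

theorem integrable_coneMoment (hd : 0 < d) {n : ℕ} (i j : Fin n → Fin d) :
    Integrable (fun x => (∏ k, mat x (i k) (j k)) * ((Real.exp (-(mat x).trace.re) : ℝ) : ℂ))
      ((hermVolume hd).restrict (coneSet d)) := by
  refine (integrableOn_coneSet_pow_mul_exp hd n one_pos).mono' ?_ ?_
  · refine Measurable.aestronglyMeasurable ?_
    have := continuous_trace_re (d := d) |>.measurable
    exact (Finset.measurable_fun_prod _ fun k _ => measurable_mat_apply _ _).mul (by fun_prop)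
  · filter_upwards [ae_mem_coneSet hd] with x hx
    rw [norm_mul, Complex.norm_real, Real.norm_of_nonneg (Real.exp_pos _).le, one_mul]
    refine mul_le_mul_of_nonneg_right ?_ (Real.exp_pos _).le
    rw [norm_prod]
    refine (Finset.prod_le_prod (fun _ _ => norm_nonneg _) fun k _ =>
      norm_apply_le_trace hx (i k) (j k)).trans_eq ?_
    simp

theorem coneMoment_variation (hd : 0 < d) {n : ℕ} (i j : Fin n → Fin d) (a b : Fin d) (c : ℂ) :
    c * ((if a = b then (d : ℂ) else 0) * coneMoment hd i j +
        ∑ k, (if i k = a then coneMoment hd (Function.update i k b) j else 0) -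
        coneMoment hd (Fin.cons b i : Fin (n + 1) → Fin d) (Fin.cons a j)) +
      star c * ((if a = b then (d : ℂ) else 0) * coneMoment hd i j +
        ∑ k, (if j k = a then coneMoment hd i (Function.update j k b) else 0) -
        coneMoment hd (Fin.cons a i : Fin (n + 1) → Fin d) (Fin.cons b j)) = 0 := by
  have h1 := (hasDerivAt_congruenceJac a b c).mul (hasDerivAt_coneMoment_congruence hd i j a b c)
  have h2 : HasDerivAt (fun _ : ℝ => coneMoment hd i j) 0 0 := hasDerivAt_const _ _
  -- Near `ε = 0` the matrix is invertible, so Jacobian times integral is constant in `ε` and its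
  -- derivative vanishes.
  have h3 := h1.unique (h2.congr_of_eventuallyEq (by
    filter_upwards [eventually_exists_inv (Matrix.single a b c)] with ε hε
    obtain ⟨T, hT⟩ := hε
    exact integral_congruence hd hT fun x =>
      (∏ k, mat x (i k) (j k)) * ((Real.exp (-(mat x).trace.re) : ℝ) : ℂ)))
  have hone : ∀ x : hermSpace d,
      mat (congruence (1 + ((0 : ℝ) : ℂ) • Matrix.single a b c) x) = mat x := by
    intro x
    rw [mat_congruence]
    simp
  simp only [hone] at h3
  have hJ : congruenceJac (1 + ((0 : ℝ) : ℂ) • Matrix.single a b c) = 1 := by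
    rw [Complex.ofReal_zero, zero_smul, add_zero, congruenceJac_one]
  rw [hJ, Complex.ofReal_one, one_mul] at h3
  let P : {n : ℕ} → (Fin n → Fin d) → (Fin n → Fin d) → hermSpace d → ℂ := fun i j x =>
    (∏ k, mat x (i k) (j k)) * ((Real.exp (-(mat x).trace.re) : ℝ) : ℂ)
  have hP : ∀ {n : ℕ} (i j : Fin n → Fin d),
      Integrable (P i j) ((hermVolume hd).restrict (coneSet d)) := fun i j =>
    integrable_coneMoment hd i j
  -- Varying a factor replaces one index, which keeps the degree `n`; varying the exponential
  -- multiplies by one more entry, which is recorded as a new slot in degree `n + 1`.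
  have hsplit : ∀ x : hermSpace d,
      ((∑ k, (∏ l ∈ Finset.univ.erase k, mat x (i l) (j l)) *
          ((if i k = a then c * mat x b (j k) else 0) +
            (if j k = a then star c * mat x (i k) b else 0))) -
          (∏ k, mat x (i k) (j k)) * (c * mat x b a + star c * mat x a b)) *
        ((Real.exp (-(mat x).trace.re) : ℝ) : ℂ) =
      c * ((∑ k, (if i k = a then (1 : ℂ) else 0) * P (Function.update i k b) j x) -
          P (Fin.cons b i : Fin (n + 1) → Fin d) (Fin.cons a j) x) +
        star c * ((∑ k, (if j k = a then (1 : ℂ) else 0) * P i (Function.update j k b) x) -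
          P (Fin.cons a i : Fin (n + 1) → Fin d) (Fin.cons b j) x) := by
    intro x
    simp only [P, Fin.prod_univ_succ, Fin.cons_zero, Fin.cons_succ, ← prod_erase_mul_update,
      ← prod_erase_mul_update_right]
    have h4 : ∑ k, (∏ l ∈ Finset.univ.erase k, mat x (i l) (j l)) *
          ((if i k = a then c * mat x b (j k) else 0) +
            (if j k = a then star c * mat x (i k) b else 0)) =
        c * ∑ k, (if i k = a then (1 : ℂ) else 0) *
          ((∏ l ∈ Finset.univ.erase k, mat x (i l) (j l)) * mat x b (j k)) +
        star c * ∑ k, (if j k = a then (1 : ℂ) else 0) *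
          ((∏ l ∈ Finset.univ.erase k, mat x (i l) (j l)) * mat x (i k) b) := by
      rw [Finset.mul_sum, Finset.mul_sum, ← Finset.sum_add_distrib]
      refine Finset.sum_congr rfl fun k _ => ?_
      split_ifs <;> ring
    rw [h4]
    simp only [← mul_assoc, ← Finset.sum_mul]
    ring
  have hI1 : ∀ (f : Fin n → ℂ) (I J : Fin n → Fin n → Fin d),
      Integrable (fun x => ∑ k, f k * P (I k) (J k) x)
        ((hermVolume hd).restrict (coneSet d)) := fun f I J =>
    integrable_finsetSum _ fun k _ => (hP _ _).const_mul _
  have hI2 : ∀ (f : Fin n → ℂ) (I J : Fin n → Fin n → Fin d),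
      ∫ x in coneSet d, ∑ k, f k * P (I k) (J k) x ∂(hermVolume hd) =
        ∑ k, f k * coneMoment hd (I k) (J k) := fun f I J => by
    rw [integral_finsetSum _ fun k _ => (hP _ _).const_mul _]
    exact Finset.sum_congr rfl fun k _ => integral_const_mul _ _
  have hI3 : ∀ (e : ℂ) (f : Fin n → ℂ) (I J : Fin n → Fin n → Fin d) (I' J' : Fin (n + 1) → Fin d),
      Integrable (fun x => e * (∑ k, f k * P (I k) (J k) x - P I' J' x))
          ((hermVolume hd).restrict (coneSet d)) ∧
        ∫ x in coneSet d, e * (∑ k, f k * P (I k) (J k) x - P I' J' x) ∂(hermVolume hd) =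
          e * (∑ k, f k * coneMoment hd (I k) (J k) - coneMoment hd I' J') := by
    intro e f I J I' J'
    refine ⟨((hI1 f I J).sub (hP I' J')).const_mul e, ?_⟩
    rw [integral_const_mul, integral_sub (hI1 f I J) (hP I' J'), hI2]
    rfl
  have hA := hI3 c (fun k => if i k = a then 1 else 0) (fun k => Function.update i k b) (fun _ => j)
    (Fin.cons b i) (Fin.cons a j)
  have hB := hI3 (star c) (fun k => if j k = a then 1 else 0) (fun _ => i)
    (fun k => Function.update j k b) (Fin.cons a i) (Fin.cons b j)
  rw [integral_congr_ae (Filter.Eventually.of_forall hsplit), integral_add hA.1 hB.1, hA.2,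
    hB.2] at h3
  change _ * coneMoment hd i j + _ = 0 at h3
  have hsum : (if a = b then (d : ℂ) * (c + star c) else 0) =
      (if a = b then (d : ℂ) else 0) * (c + star c) := by
    rw [ite_mul, zero_mul]
  rw [hsum] at h3
  generalize (if a = b then (d : ℂ) else 0) = D at h3 ⊢
  simp only [ite_mul, one_mul, zero_mul] at h3
  linear_combination h3

/-- The variation is only real linear in `c`; the values `c = 1` and `c = i` together isolate the
coefficient of `c` from that of its conjugate. -/
theorem coneMoment_cons (hd : 0 < d) {n : ℕ} (i j : Fin n → Fin d) (a b : Fin d) :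
    coneMoment hd (Fin.cons a i : Fin (n + 1) → Fin d) (Fin.cons b j) =
      (if a = b then (d : ℂ) else 0) * coneMoment hd i j +
        ∑ k, (if i k = b then coneMoment hd (Function.update i k a) j else 0) := by
  have h1 := coneMoment_variation hd i j b a 1
  have h2 := coneMoment_variation hd i j b a Complex.I
  rw [star_one] at h1
  rw [Complex.star_def, Complex.conj_I] at h2
  have key : ∀ x y : ℂ, 1 * x + 1 * y = 0 → Complex.I * x + -Complex.I * y = 0 → x = 0 := by
    intro x y hx hy
    linear_combination (1 / 2 : ℂ) * hx - Complex.I / 2 * hy + (x - y) / 2 * Complex.I_mul_I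
  have h3 := key _ _ h1 h2
  simp only [eq_comm (a := b) (b := a)] at h3
  exact (sub_eq_zero.1 h3).symm

theorem coneMoment_eq_symmetricTrace (hd : 0 < d) {n : ℕ} (i j : Fin n → Fin d) :
    coneMoment hd i j = symmetricTrace n d i j *
      coneMoment hd (Fin.elim0 : Fin 0 → Fin d) Fin.elim0 := by
  induction n with
  | zero =>
    rw [symmetricTrace_zero, one_mul, Subsingleton.elim i Fin.elim0,
      Subsingleton.elim j Fin.elim0]
  | succ n ih =>
    rw [← Fin.cons_self_tail i, ← Fin.cons_self_tail j, coneMoment_cons, symmetricTrace_cons,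
      add_mul, Finset.sum_mul, ih, mul_assoc]
    congr 1
    refine Finset.sum_congr rfl fun k _ => ?_
    split_ifs
    · rw [ih]
    · rw [zero_mul]

/-- The constant is the ratio of the radial integrals in degrees `n` and 0: `(d² - 1 + n)! / (d² -
1)! = g n!`. -/
theorem deFinettiState_eq_symmetricTrace (hd : 0 < d) (n : ℕ) :
    (((postSelectionConst n d : ℕ) * n.factorial : ℂ)) • deFinettiState n d =
      symmetricTrace n d := by
  ext i j
  set V := (tracelessVolume d (densitySet hd)).toReal with hV
  have hVpos : 0 < V :=
    ENNReal.toReal_pos (measure_densitySet_pos hd).ne' (measure_densitySet_lt_top hd).ne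
  have h0 : densityMoment hd (Fin.elim0 : Fin 0 → Fin d) Fin.elim0 = V := by
    simp [densityMoment, Measure.real, hV]
  have h1 := coneMoment_eq_symmetricTrace hd i j
  rw [coneMoment_eq, coneMoment_eq, h0, add_zero] at h1
  have hN : n + d ^ 2 - 1 = n + (d ^ 2 - 1) :=
    Nat.add_sub_assoc (Nat.one_le_pow _ _ hd) n
  have h2 : ((d ^ 2 - 1 + n).factorial : ℂ) =
      postSelectionConst n d * n.factorial * (d ^ 2 - 1).factorial := by
    rw [postSelectionConst, hN, add_comm (d ^ 2 - 1), Nat.choose_symm_add]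
    exact_mod_cast (Nat.add_choose_mul_factorial_mul_factorial n (d ^ 2 - 1)).symm
  have hV' : (V : ℂ) ≠ 0 := by exact_mod_cast hVpos.ne'
  have hf : ((d ^ 2 - 1).factorial : ℂ) ≠ 0 := by exact_mod_cast Nat.factorial_ne_zero _
  rw [h2] at h1
  rw [Matrix.smul_apply, smul_eq_mul, deFinettiState_eq_densityMoment hd, ← hV]
  refine mul_right_cancel₀ (mul_ne_zero hf hV') (Eq.trans ?_ h1)
  field_simp

end MomentRecursion

/-! ### The polynomial bound on the constant and the conclusion. -/

theorem add_choose_le_pow (n N : ℕ) : (n + N).choose n ≤ (n + 1) ^ N := by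
  induction N with
  | zero => simp
  | succ N ih =>
    have h := Nat.add_one_mul_choose_eq (n + N) N
    rw [Nat.choose_symm_add] at ih ⊢
    refine Nat.le_of_mul_le_mul_right ?_ N.succ_pos
    -- Each step multiplies the binomial by `(n + N + 1) / (N + 1) ≤ n + 1`.
    calc (n + (N + 1)).choose (N + 1) * (N + 1) = (n + N + 1) * (n + N).choose N := h.symm
      _ ≤ ((n + 1) * (N + 1)) * (n + 1) ^ N := Nat.mul_le_mul (by nlinarith) ih
      _ = (n + 1) ^ (N + 1) * (N + 1) := by ring

theorem dominates_deFinettiState {n d : ℕ} (hd : 0 < d)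
    {M : Matrix (Fin n → Fin d) (Fin n → Fin d) ℂ} (hM : M.PosSemidef)
    (hinv : ∀ (π : Equiv.Perm (Fin n)) i j, M (i ∘ π) (j ∘ π) = M i j) (htr : M.trace.re ≤ 1) :
    ((((postSelectionConst n d : ℝ)) : ℂ) • deFinettiState n d - M).PosSemidef := by
  have h := posSemidef_symmetricTrace_sub hM hinv htr
  have hn : (0 : ℝ) < (n.factorial : ℝ)⁻¹ := by positivity
  have hn' : (n.factorial : ℂ) ≠ 0 := by exact_mod_cast n.factorial_ne_zero
  have h2 := h.smul (a := (((n.factorial : ℝ)⁻¹ : ℝ) : ℂ)) (by exact_mod_cast hn.le)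
  rw [← deFinettiState_eq_symmetricTrace hd] at h2
  convert h2 using 1
  rw [smul_sub, smul_smul, smul_smul]
  push_cast
  rw [inv_mul_cancel₀ hn', one_smul]
  congr 2
  field_simp

end

end PostSelection

theorem theorem1 (n d : ℕ) (hd : 0 < d)
    {m : Type*} [Fintype m] [DecidableEq m] {r : Type*} [Fintype r] [DecidableEq r]
    (Δ : Matrix (Fin n → Fin d) (Fin n → Fin d) ℂ →ₗ[ℂ] Matrix m m ℂ)
    (hΔ : ∀ π : Equiv.Perm (Fin n), ∃ K : Matrix m m ℂ →ₗ[ℂ] Matrix m m ℂ,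
      PostSelection.IsCPTP K ∧ Δ ∘ₗ PostSelection.permMap d π = K ∘ₗ Δ)
    (τ : Matrix ((Fin n → Fin d) × r) ((Fin n → Fin d) × r) ℂ)
    (hτ : PostSelection.IsPurification τ (PostSelection.deFinettiState n d)) :
    PostSelection.diamondNorm Δ ≤ ENNReal.ofReal
        ((PostSelection.postSelectionConst n d : ℝ) *
          PostSelection.traceNorm (PostSelection.tensorId Δ r τ)) ∧
      PostSelection.postSelectionConst n d ≤ (n + 1) ^ (d ^ 2 - 1) := by
  refine ⟨?_, ?_⟩
  · refine iSup_le fun k => iSup_le fun σ => iSup_le fun hσ => ENNReal.ofReal_le_ofReal ?_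
    exact PostSelection.traceNorm_tensorId_le_of_dominates Δ hΔ (Nat.cast_nonneg _)
      (fun _ hM hinv htr => PostSelection.dominates_deFinettiState hd hM hinv htr) hτ hσ
  · rw [PostSelection.postSelectionConst, Nat.add_sub_assoc (Nat.one_le_pow _ _ hd)]
    exact PostSelection.add_choose_le_pow n _
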